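/- **Setting.** The cake is $C=[0,1]$; a valuation is an atomless Borel probability measure on $C$. A *protocol* for players $A_1,\dots,A_n;B_1,\dots,B_m$ is a well-founded decision tree (every execution is finite, but the number of steps need not be bounded) in the Robertson–Webb query model. It starts with the single fragment $C$. In each step, depending on the answers so far, it asks a player for her value of a present fragment, or asks a player to cut a present fragment $F$ into a left and a right part such that the left part is worth a given fraction $t\in[0,1]$ of $F$ to her (this is one cut; its location becomes public), or announces that a present group $G$ of at least three $A$-players is partitioned into two nonempty sets $S$ and $G\setminus S$, or ends by giving each fragment to one of the $A$-players. At first all $A$-players form one group; an announcement replaces $G$ by the groups $S$ and $G\setminus S$. It may be made only if there are unions $P\subseteq C'$ of present fragments such that $C'$ has positive value for all players in $G$ and, with the value of $C'$ normalized to $1$, $P$ is worth exactly $\alpha$ to everyone in $S$ and at most $\beta$ to everyone in $G\setminus S$, for some $\alpha>\beta$. A protocol *takes $\zeta$ cuts*, for an ordinal $\zeta$, if an observer who sees only the answers and the cut locations can keep an ordinal counter that starts at $\zeta$, decreases strictly at every cut, and does not change otherwise. An execution *uses up an $\omega$* at each cut at which the counter falls from $\omega\cdot a+b$ to $\omega\cdot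 a'+b'$ with $a'<a$ and $b,b'$ finite. *Random partitions.* Let $\sigma$ assign to every set $G$ of at least three $A$-players a nonempty proper subset $\sigma(G)\subset G$. An execution *follows* $\sigma$ if $S=\sigma(G)$ in all of its announcements. Put $T_\sigma(G)=0$ if $|G|=1$, $T_\sigma(G)=1$ if $|G|=2$, and $T_\sigma(G)=2+T_\sigma(\sigma(G))+T_\sigma(G\setminus\sigma(G))$ if $|G|\ge 3$. In the random-partition model, $\sigma$ is uniformly random among all such assignments, that is, every group is partitioned independently and uniformly over its nontrivial partitions. **Theorem.** Let $n\ge 1$, $m\ge 0$ and $\varepsilon>0$. There are a protocol for $A_1,\dots,A_n;B_1,\dots,B_m$ and an observer such that, for all valuations, the protocol can be executed, and every execution in which all players answer and cut according to their valuations has the following properties. 1. The cake is divided into $n$ pieces, one for each of $A_1,\dots,A_n$ (the $B$-players get nothing), and the division is envy-free for $A_1,\dots,A_n$: each of them values her own piece at least as much as any other piece. 2. All of $A_1,\dots,A_n,B_1,\dots,B_m$ think that every piece is within $\varepsilon$ of $\frac1n$. The number of cuts is as follows. 1. Worst case: the protocol takes $\omega\cdot(2n-3)$ cuts if $n\ge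 2$, and no cuts if $n=1$. 2. Average case: with the same observer, every execution that follows $\sigma$ uses up at most $T_\sigma(\{A_1,\dots,A_n\})$ $\omega$'s, and the average of $T_\sigma(\{A_1,\dots,A_n\})$ over uniformly random $\sigma$ is at most $2n-3$ if $n\ge2$ (and at most $0$ if $n=1$). Thus in the random-partition model at most $2n-3=2n-O(1)$ $\omega$'s are used on average. -/

import Mathlib

open MeasureTheory Set

noncomputable section

namespace CakeCutting

/-- The cake. -/
abbrev Cake : Type := unitInterval

/-- The players: `Sum.inl a` are the `A`-players, `Sum.inr b` are the `B`-players. -/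
abbrev Player (n m : ℕ) : Type := Fin n ⊕ Fin m

/-- A valuation is a divisible (atomless) additive measure for which the whole cake has value 1. -/
def IsValuation (μ : Measure Cake) : Prop := IsProbabilityMeasure μ ∧ NullSingletonClass μ

/-- Discrete protocols in the Robertson-Webb query model, for `n` `A`-players and `m` `B`-players,
started when the cake lies in `k` fragments. As an inductive type, a protocol is a well-founded
tree: every execution is finite, but there need not be a common bound on the lengths.

* `assign owner` ends the protocol; fragment `j` is given to the `A`-player `owner j`.
* `query q j next`: player `q` announces the value of fragment `j`.
* `cut q j t next`: player `q` cuts fragment `j` in two, such that the left part is worth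
  the fraction `t` of fragment `j` to `q`; this is one cut, and its location is public.
  The left part keeps the number `j`, the right part becomes the new last fragment.
* `regroup G S C P next`: it is announced that the group `G` of `A`-players is partitioned into
  `S` and `G \ S`, because these two sets of players disagree on how much of the piece `C` the
  piece `P` is worth. The pieces `C` and `P` are unions of present fragments. Nothing is cut. -/
inductive Protocol (n m : ℕ) : ℕ → Type
  | assign {k : ℕ} (owner : Fin k → Fin n) : Protocol n m k
  | query {k : ℕ} (q : Player n m) (j : Fin k) (next : ℝ → Protocol n m k) : Protocol n m k
  | cut {k : ℕ} (q : Player n m) (j : Fin k) (t : unitInterval)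
      (next : Cake → Protocol n m (k + 1)) : Protocol n m k
  | regroup {k : ℕ} (G S : Finset (Fin n)) (C P : Finset (Fin k))
      (next : Protocol n m k) : Protocol n m k

/-- The publicly visible steps of an execution. -/
inductive Step (n : ℕ) : Type
  | answer (r : ℝ) : Step n
  | cutAt (x : Cake) : Step n
  | regroup (G S : Finset (Fin n)) (C P : Set Cake) : Step n

/-- The fragments after fragment `j` has been cut at the point `x`. -/
def cutFragment {k : ℕ} (F : Fin k → Set Cake) (j : Fin k) (x : Cake) : Fin (k + 1) → Set Cake :=
  Fin.snoc (α := fun _ => Set Cake) (Function.update F j (F j ∩ Iic x)) (F j ∩ Ioi x)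

/-- The union of the fragments whose number lies in `J`. -/
def unionOf {k : ℕ} (F : Fin k → Set Cake) (J : Finset (Fin k)) : Set Cake := ⋃ j ∈ J, F j

/-- `IsRun v p F h X`: for players with valuations `v` who follow the rules, the protocol `p`,
started with the fragments `F`, can be executed with the list of steps `h`, and then gives the
piece `X a` to the `A`-player `a`. A player who has several ways to cut as requested may use
any of them. -/
def IsRun {n m : ℕ} (v : Player n m → Measure Cake) :
    {k : ℕ} → Protocol n m k → (Fin k → Set Cake) → List (Step n) → (Fin n → Set Cake) → Prop
  | _, .assign owner, F, h, X =>
      h = [] ∧ X = fun a => unionOf F (Finset.univ.filter fun j => owner j = a)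
  | _, .query q j next, F, h, X =>
      ∃ h', h = .answer ((v q).real (F j)) :: h' ∧ IsRun v (next ((v q).real (F j))) F h' X
  | _, .cut q j t next, F, h, X =>
      ∃ x h', (v q).real (F j ∩ Iic x) = (t : ℝ) * (v q).real (F j) ∧
        h = .cutAt x :: h' ∧ IsRun v (next x) (cutFragment F j x) h' X
  | _, .regroup G S C P next, F, h, X =>
      ∃ h', h = .regroup G S (unionOf F C) (unionOf F P) :: h' ∧ IsRun v next F h' X

/-- An execution on the whole cake. -/
def IsFullRun {n m : ℕ} (v : Player n m → Measure Cake) (p : Protocol n m 1)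
    (h : List (Step n)) (X : Fin n → Set Cake) : Prop :=
  IsRun v p (fun _ => univ) h X

/-- The pieces `X a` form a division of the whole cake. -/
def IsDivision {n : ℕ} (X : Fin n → Set Cake) : Prop :=
  (⋃ a, X a) = univ ∧ Pairwise fun a b => Disjoint (X a) (X b)

/-- No `A`-player thinks that another `A`-player has a better piece. -/
def IsEnvyFree {n m : ℕ} (v : Player n m → Measure Cake) (X : Fin n → Set Cake) : Prop :=
  ∀ a b : Fin n, (v (.inl a)).real (X b) ≤ (v (.inl a)).real (X a)

/-- All players, of both kinds, think that every piece is within `ε` of `1 / n`. -/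
def IsNearExact {n m : ℕ} (v : Player n m → Measure Cake) (ε : ℝ) (X : Fin n → Set Cake) : Prop :=
  ∀ (q : Player n m) (a : Fin n), |(v q).real (X a) - 1 / (n : ℝ)| ≤ ε

/-! ### Counting cuts by ordinals -/

/-- The outside observer, who holds an ordinal counter. The value of the counter depends only on
the steps made so far (the answers and the cut locations), not on the valuations. -/
abbrev Observer (n : ℕ) : Type 1 := List (Step n) → Ordinal.{0}

/-- During the execution `h`, the counter is decreased at every cut and not changed otherwise. -/
def CounterWorks {n : ℕ} (obs : Observer n) (h : List (Step n)) : Prop :=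
  ∀ (g : List (Step n)) (s : Step n), (g ++ [s]) <+: h →
    match s with
    | .cutAt _ => obs (g ++ [s]) < obs g
    | _ => obs (g ++ [s]) = obs g

open Classical in
/-- The number of times an `ω` of the counter is used up during the execution `h`: the number of
steps at which the counter falls from `ω * a + b` to `ω * a' + b'` with `a' < a`
(where `b` and `b'` are finite if the counter is below `ω * ω`). -/
def omegaCount {n : ℕ} (obs : Observer n) (h : List (Step n)) : ℕ :=
  ((Finset.range h.length).filter fun i =>
    obs (h.take (i + 1)) / Ordinal.omega0 < obs (h.take i) / Ordinal.omega0).card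

/-! ### Partitions of the `A`-players -/

/-- The piece `P` of `C` is controversial for the group `G` because of the nontrivial partition
`S`, `G \ S`: with the value of `C` normalized to 1, everyone in `S` thinks that `P` is worth `α`,
and everyone in `G \ S` thinks that `P` is worth at most `β`, where `β < α`. -/
def IsControversial {n m : ℕ} (v : Player n m → Measure Cake) (G S : Finset (Fin n))
    (C P : Set Cake) : Prop :=
  S.Nonempty ∧ S ⊂ G ∧ P ⊆ C ∧ (∀ a ∈ G, 0 < (v (.inl a)).real C) ∧
    ∃ α β : ℝ, β < α ∧
      (∀ a ∈ S, (v (.inl a)).real P = α * (v (.inl a)).real C) ∧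
      ∀ a ∈ G \ S, (v (.inl a)).real P ≤ β * (v (.inl a)).real C

/-- The groups after the steps `h`: all `A`-players form one group at first, and a
partition replaces a group by its two parts. -/
def groupsAfter {n : ℕ} (h : List (Step n)) : Finset (Finset (Fin n)) :=
  h.foldl (fun L s =>
    match s with
    | .regroup G S _ _ => insert S (insert (G \ S) (L.erase G))
    | _ => L) {Finset.univ}

/-- Every partition announced during `h` is one of a present group with at least three players,
and comes from a controversial piece. -/
def PartitionsGenuine {n m : ℕ} (v : Player n m → Measure Cake) (h : List (Step n)) : Prop :=
  ∀ (g : List (Step n)) (G S : Finset (Fin n)) (C P : Set Cake),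
    (g ++ [Step.regroup G S C P]) <+: h →
      G ∈ groupsAfter g ∧ 3 ≤ G.card ∧ IsControversial v G S C P

/-- A way to partition every group of at least three `A`-players into two nonempty parts
`σ G` and `G \ σ G`. A uniformly random `σ` describes random partitions: the parts of the different
groups are independent, and each is uniformly distributed over the nontrivial partitions. -/
abbrev PartitionRule (n : ℕ) : Type :=
  (G : {G : Finset (Fin n) // 3 ≤ G.card}) → {S : Finset (Fin n) // S.Nonempty ∧ S ⊂ G.1}

/-- All partitions announced during `h` are those that `σ` prescribes. -/
def FollowsRule {n : ℕ} (σ : PartitionRule n) (h : List (Step n)) : Prop :=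
  ∀ (G S : Finset (Fin n)) (C P : Set Cake) (hG : 3 ≤ G.card),
    Step.regroup G S C P ∈ h → S = (σ ⟨G, hG⟩).1

/-- The number of `ω`s for a group that is partitioned recursively by `σ`: none for one player,
one for two players, and otherwise two, plus those for both parts. -/
def omegaCost {n : ℕ} (σ : PartitionRule n) (G : Finset (Fin n)) : ℕ :=
  if h : 3 ≤ G.card then
    2 + omegaCost σ (σ ⟨G, h⟩).1 + omegaCost σ (G \ (σ ⟨G, h⟩).1)
  else G.card - 1
termination_by G.card
decreasing_by
  · exact Finset.card_lt_card (σ ⟨G, h⟩).2.2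
  · exact Finset.card_lt_card
      (Finset.sdiff_ssubset (σ ⟨G, h⟩).2.2.subset (σ ⟨G, h⟩).2.1)

/-- The average of `omegaCost` for all `n` `A`-players, over a uniformly random `σ`. -/
def averageOmegaCost (n : ℕ) : ℝ :=
  (∑ σ : PartitionRule n, (omegaCost σ Finset.univ : ℝ)) / (Fintype.card (PartitionRule n) : ℝ)

end CakeCutting

end

noncomputable section

namespace CakeCutting

/-! A group `G` divides a piece `C` recursively. One member `p` has `C` divided into `|G|` parts
that are equal for `p` and nearly equal for everybody. With two players, the other one chooses. If
all members find the parts exactly equal, any allocation is envy-free. Otherwise some part is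
controversial: `S` consists of the members with the largest relative value for it. Mixing this part
into a proportional share yields `D ⊆ C` that everyone in `S` values at more than `|S| / |G|` of
`C`, and everyone in `G \ S` at less, by a margin `κ > 0` (`reach_advantage`). Now `S` divides `D`
and `G \ S` divides `C \ D`, with an error small compared with `κ`; the margin then rules out envy
between the two groups (`Stage.IsShare.combine`). The induction is `reach_hasDivided`.

Near-exactness comes from rounding. Once all fragments are small for all players, a random choice
per fragment has small total variance, so a good choice exists (`exists_choice_sum_sq_le`). The
number of cuts needed depends on the current number of fragments and on `κ`. It is unknown at the
start but known when the refinement begins, so a refinement costs one `ω`. A group of at least three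
players needs at most two refinements of its own, which gives the recursion of `omegaCost`, bounded
by `2 * |G| - 3` for every partition rule.

The strategy is not written as a decision tree. `Reach` describes it through public knowledge,
namely the set of valuations compatible with the answers, and `Reach.exists_protocol` turns it into
a protocol with an observer. -/

/-! ### Fragments -/

/-- The fragments are measurable and form a partition of the cake. -/
structure IsFragmentation {k : ℕ} (F : Fin k → Set Cake) : Prop where
  measurable : ∀ j, MeasurableSet (F j)
  disjoint : Pairwise fun i j => Disjoint (F i) (F j)
  cover : ∀ x, ∃ j, x ∈ F j

/-- The piece `C` does not separate points of a fragment. -/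
def Adapted {k : ℕ} (F : Fin k → Set Cake) (C : Set Cake) : Prop :=
  ∀ j, F j ⊆ C ∨ Disjoint (F j) C

open Classical in
/-- The numbers of the fragments that are contained in `C`. -/
def fragmentsIn {k : ℕ} (F : Fin k → Set Cake) (C : Set Cake) : Finset (Fin k) :=
  Finset.univ.filter fun j => F j ⊆ C

lemma mem_unionOf {k : ℕ} {F : Fin k → Set Cake} {J : Finset (Fin k)} {x : Cake} :
    x ∈ unionOf F J ↔ ∃ j ∈ J, x ∈ F j := by
  simp [unionOf]

lemma mem_fragmentsIn {k : ℕ} {F : Fin k → Set Cake} {C : Set Cake} {j : Fin k} :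
    j ∈ fragmentsIn F C ↔ F j ⊆ C := by
  simp [fragmentsIn]

namespace Adapted

variable {k : ℕ} {F : Fin k → Set Cake} {C D : Set Cake}

lemma univ : Adapted F univ := fun _ => Or.inl (subset_univ _)

lemma inter (hC : Adapted F C) (hD : Adapted F D) : Adapted F (C ∩ D) := fun j => by
  rcases hC j with h | h
  · rcases hD j with h' | h'
    · exact Or.inl (subset_inter h h')
    · exact Or.inr (h'.mono_right inter_subset_right)
  · exact Or.inr (h.mono_right inter_subset_left)

lemma compl (hC : Adapted F C) : Adapted F Cᶜ := fun j => by
  rcases hC j with h | h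
  · exact Or.inr (disjoint_compl_right.mono_left h)
  · exact Or.inl (subset_compl_iff_disjoint_right.2 h)

lemma diff (hC : Adapted F C) (hD : Adapted F D) : Adapted F (C \ D) := hC.inter hD.compl

lemma iUnion {ι : Sort*} {Y : ι → Set Cake} (hY : ∀ i, Adapted F (Y i)) :
    Adapted F (⋃ i, Y i) := fun j => by
  by_cases h : ∃ i, F j ⊆ Y i
  · obtain ⟨i, hi⟩ := h
    exact Or.inl (hi.trans (subset_iUnion Y i))
  · push Not at h
    exact Or.inr (disjoint_iUnion_right.2 fun i => (hY i j).resolve_left (h i))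

lemma refine (hC : Adapted F C) {k' : ℕ} {F' : Fin k' → Set Cake}
    (h : ∀ j', ∃ j, F' j' ⊆ F j) : Adapted F' C := fun j' => by
  obtain ⟨j, hj⟩ := h j'
  exact (hC j).imp (fun h => hj.trans h) fun h => h.mono_left hj

lemma unionOf_fragmentsIn (hC : Adapted F C) (hF : IsFragmentation F) :
    unionOf F (fragmentsIn F C) = C := by
  ext x
  simp only [mem_unionOf, mem_fragmentsIn]
  constructor
  · rintro ⟨j, hj, hx⟩
    exact hj hx
  · intro hx
    obtain ⟨j, hj⟩ := hF.cover x
    exact ⟨j, (hC j).resolve_right fun h => disjoint_left.1 h hj hx, hj⟩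

lemma measurableSet (hC : Adapted F C) (hF : IsFragmentation F) : MeasurableSet C := by
  rw [← hC.unionOf_fragmentsIn hF]
  exact Finset.measurableSet_biUnion _ fun j _ => hF.measurable j

end Adapted

namespace IsFragmentation

variable {k : ℕ} {F : Fin k → Set Cake}

lemma adapted_fragment (hF : IsFragmentation F) (i : Fin k) : Adapted F (F i) := fun j => by
  by_cases h : j = i
  · exact Or.inl (h ▸ subset_rfl)
  · exact Or.inr (hF.disjoint h)

lemma adapted_unionOf (hF : IsFragmentation F) (J : Finset (Fin k)) : Adapted F (unionOf F J) :=
  Adapted.iUnion fun j => Adapted.iUnion fun _ => hF.adapted_fragment j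

lemma measureReal_unionOf (hF : IsFragmentation F) (μ : Measure Cake) [IsFiniteMeasure μ]
    (J : Finset (Fin k)) : μ.real (unionOf F J) = ∑ j ∈ J, μ.real (F j) :=
  measureReal_biUnion_finset (fun _ _ _ _ h => hF.disjoint h) fun j _ => hF.measurable j

lemma measureReal_eq_sum (hF : IsFragmentation F) (μ : Measure Cake) [IsFiniteMeasure μ]
    {C : Set Cake} (hC : Adapted F C) : μ.real C = ∑ j ∈ fragmentsIn F C, μ.real (F j) := by
  rw [← hF.measureReal_unionOf, hC.unionOf_fragmentsIn hF]

end IsFragmentation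

lemma cutFragment_last {k : ℕ} (F : Fin k → Set Cake) (j : Fin k) (x : Cake) :
    cutFragment F j x (Fin.last k) = F j ∩ Ioi x := by
  simp [cutFragment]

lemma cutFragment_castSucc_self {k : ℕ} (F : Fin k → Set Cake) (j : Fin k) (x : Cake) :
    cutFragment F j x j.castSucc = F j ∩ Iic x := by
  simp [cutFragment]

lemma cutFragment_castSucc_of_ne {k : ℕ} (F : Fin k → Set Cake) {i j : Fin k} (h : i ≠ j)
    (x : Cake) : cutFragment F j x i.castSucc = F i := by
  simp [cutFragment, Function.update_of_ne h]

lemma cutFragment_castSucc_subset {k : ℕ} (F : Fin k → Set Cake) (i j : Fin k) (x : Cake) :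
    cutFragment F j x i.castSucc ⊆ F i := by
  by_cases h : i = j
  · subst h
    rw [cutFragment_castSucc_self]
    exact inter_subset_left
  · rw [cutFragment_castSucc_of_ne F h]

lemma cutFragment_subset {k : ℕ} (F : Fin k → Set Cake) (j : Fin k) (x : Cake)
    (i : Fin (k + 1)) : ∃ i', cutFragment F j x i ⊆ F i' := by
  induction i using Fin.lastCases with
  | last => exact ⟨j, by rw [cutFragment_last]; exact inter_subset_left⟩
  | cast i => exact ⟨i, cutFragment_castSucc_subset F i j x⟩

lemma IsFragmentation.cutFragment {k : ℕ} {F : Fin k → Set Cake} (hF : IsFragmentation F)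
    (j : Fin k) (x : Cake) : IsFragmentation (cutFragment F j x) where
  measurable i := by
    induction i using Fin.lastCases with
    | last => rw [cutFragment_last]; exact (hF.measurable j).inter measurableSet_Ioi
    | cast i =>
      by_cases h : i = j
      · subst h
        rw [cutFragment_castSucc_self]; exact (hF.measurable _).inter measurableSet_Iic
      · rw [cutFragment_castSucc_of_ne F h]; exact hF.measurable i
  disjoint := by
    have key : ∀ i : Fin k,
        Disjoint (CakeCutting.cutFragment F j x i.castSucc) (F j ∩ Ioi x) := by
      intro i
      by_cases h : i = j
      · subst h
        rw [cutFragment_castSucc_self]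
        refine Disjoint.mono inter_subset_right inter_subset_right ?_
        exact disjoint_left.2 fun y hy hy' => not_lt.2 (mem_Iic.1 hy) (mem_Ioi.1 hy')
      · rw [cutFragment_castSucc_of_ne F h]
        exact (hF.disjoint h).mono_right inter_subset_left
    intro i i' h
    induction i using Fin.lastCases with
    | last =>
      induction i' using Fin.lastCases with
      | last => exact absurd rfl h
      | cast i' => rw [cutFragment_last]; exact (key i').symm
    | cast i =>
      induction i' using Fin.lastCases with
      | last => rw [cutFragment_last]; exact key i
      | cast i' =>
        exact (hF.disjoint fun e => h (congrArg Fin.castSucc e)).mono (cutFragment_castSucc_subset F i j x)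
          (cutFragment_castSucc_subset F i' j x)
  cover y := by
    obtain ⟨i, hi⟩ := hF.cover y
    by_cases h : i = j
    · subst h
      by_cases hy : y ≤ x
      · exact ⟨i.castSucc, by rw [cutFragment_castSucc_self]; exact ⟨hi, hy⟩⟩
      · exact ⟨Fin.last k, by rw [cutFragment_last]; exact ⟨hi, not_le.1 hy⟩⟩
    · exact ⟨i.castSucc, by rwa [cutFragment_castSucc_of_ne F h]⟩

/-- As the cut point tends to `x`, the indicators converge everywhere except possibly at `x`, which
is a null set because the valuation has no atoms. -/
lemma continuous_measureReal_inter_Iic (μ : Measure Cake) (hμ : IsValuation μ) {s : Set Cake}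
    (hs : MeasurableSet s) : Continuous fun x => μ.real (s ∩ Iic x) := by
  obtain ⟨_, _⟩ := hμ
  rw [continuous_iff_continuousAt]
  intro x
  refine (ENNReal.continuousAt_toReal (measure_ne_top μ _)).tendsto.comp ?_
  refine tendsto_measure_of_ae_tendsto_indicator_of_isFiniteMeasure _
    (hs.inter measurableSet_Iic) (fun y => hs.inter measurableSet_Iic) ?_
  have : ∀ᵐ z ∂μ, z ≠ x := by
    rw [ae_iff]
    simp
  filter_upwards [this] with z hz
  rcases lt_or_gt_of_ne hz with h | h
  · filter_upwards [lt_mem_nhds h] with y hy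
    simp [h.le, hy.le]
  · filter_upwards [gt_mem_nhds h] with y hy
    simp [not_le.2 h, not_le.2 hy]

/-- A player can always cut a fragment as requested. -/
lemma exists_cut (μ : Measure Cake) (hμ : IsValuation μ) {s : Set Cake} (hs : MeasurableSet s)
    (t : unitInterval) : ∃ x, μ.real (s ∩ Iic x) = (t : ℝ) * μ.real s := by
  have hc := continuous_measureReal_inter_Iic μ hμ hs
  obtain ⟨_, _⟩ := hμ
  refine mem_range_of_exists_le_of_exists_ge hc ⟨0, ?_⟩ ⟨1, ?_⟩
  · have : μ.real (s ∩ Iic 0) = 0 := by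
      rw [measureReal_eq_zero_iff]
      refine measure_mono_null (t := {0}) ?_ (by simp)
      rintro y ⟨-, hy⟩
      exact le_antisymm hy unitInterval.nonneg'
    rw [this]
    exact mul_nonneg t.2.1 measureReal_nonneg
  · have : s ∩ Iic 1 = s := inter_eq_left.2 fun y _ => unitInterval.le_one'
    rw [this]
    exact mul_le_of_le_one_left measureReal_nonneg t.2.2

/-! ### Stages of an execution -/

/-- The public knowledge at a stage of an execution: the fragments, the set `V` of valuations
that agree with the answers, and the groups. The numbers `a`, `b` and `c` are a budget: the counter
may be at `ω * a + b`, and at most `c σ` further `ω`s may be used up if `σ` is followed. -/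
structure Stage (n m : ℕ) where
  k : ℕ
  F : Fin k → Set Cake
  V : Set (Player n m → Measure Cake)
  L : Finset (Finset (Fin n))
  a : ℕ
  b : ℕ
  c : PartitionRule n → ℕ

variable {n m : ℕ}

/-- Starting from the stage `s`, one can reach a stage with the property `Q` whatever the
answers are. -/
inductive Reach (Q : Stage n m → Prop) : Stage n m → Prop
  | done {s : Stage n m} : Q s → Reach Q s
  | query {s : Stage n m} (q : Player n m) (j : Fin s.k) :
      (∀ r, {v ∈ s.V | (v q).real (s.F j) = r}.Nonempty →
        Reach Q { s with V := {v ∈ s.V | (v q).real (s.F j) = r} }) → Reach Q s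
  | cut {s : Stage n m} (b : ℕ) (q : Player n m) (j : Fin s.k) (t : unitInterval) :
      s.b = b + 1 →
      (∀ x, {v ∈ s.V | (v q).real (s.F j ∩ Iic x) = (t : ℝ) * (v q).real (s.F j)}.Nonempty →
        Reach Q { s with
          k := s.k + 1
          F := cutFragment s.F j x
          V := {v ∈ s.V | (v q).real (s.F j ∩ Iic x) = (t : ℝ) * (v q).real (s.F j)}
          b := b }) → Reach Q s
  | drop {s : Stage n m} (a b : ℕ) (c : PartitionRule n → ℕ) :
      a < s.a → (∀ σ, c σ + 1 ≤ s.c σ) → Reach Q { s with a := a, b := b, c := c } → Reach Q s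
  | regroup {s : Stage n m} (G S : Finset (Fin n)) (C P : Finset (Fin s.k))
      (c : PartitionRule n → ℕ) (hG : 3 ≤ G.card) : G ∈ s.L →
      (∀ v ∈ s.V, IsControversial v G S (unionOf s.F C) (unionOf s.F P)) →
      (∀ σ : PartitionRule n, S = (σ ⟨G, hG⟩).1 → c σ ≤ s.c σ) →
      Reach Q { s with L := insert S (insert (G \ S) (s.L.erase G)), c := c } → Reach Q s

lemma Reach.bind {Q Q' : Stage n m → Prop} {s : Stage n m} (h : Reach Q s)
    (h' : ∀ s', Q s' → Reach Q' s') : Reach Q' s := by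
  induction h with
  | done h => exact h' _ h
  | query q j _ ih => exact .query q j ih
  | cut b q j t hb _ ih => exact .cut b q j t hb ih
  | drop a b c ha hc _ ih => exact .drop a b c ha hc ih
  | regroup G S C P c hG hL hv hc _ ih => exact .regroup G S C P c hG hL hv hc ih

/-- The stage describes a situation that can occur. -/
structure Stage.Good (s : Stage n m) : Prop where
  frag : IsFragmentation s.F
  nonempty : s.V.Nonempty
  valuation : ∀ v ∈ s.V, ∀ q, IsValuation (v q)

/-- The stage `s'` can occur after the stage `s`. -/
structure Stage.Extends (s' s : Stage n m) : Prop where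
  subset : s'.V ⊆ s.V
  refines : ∀ j', ∃ j, s'.F j' ⊆ s.F j
  good : s.Good → s'.Good

lemma Stage.Extends.refl (s : Stage n m) : s.Extends s :=
  ⟨subset_rfl, fun j => ⟨j, subset_rfl⟩, id⟩

lemma Stage.Extends.trans {s₁ s₂ s₃ : Stage n m} (h : s₃.Extends s₂) (h' : s₂.Extends s₁) :
    s₃.Extends s₁ := by
  refine ⟨h.subset.trans h'.subset, fun j => ?_, fun g => h.good (h'.good g)⟩
  obtain ⟨i, hi⟩ := h.refines j
  obtain ⟨l, hl⟩ := h'.refines i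
  exact ⟨l, hi.trans hl⟩

lemma Stage.extends_cut (s : Stage n m) (j : Fin s.k) (x : Cake)
    (V : Set (Player n m → Measure Cake)) (hV : V ⊆ s.V) (hne : V.Nonempty) (b : ℕ) :
    Stage.Extends { s with k := s.k + 1, F := cutFragment s.F j x, V := V, b := b } s :=
  ⟨hV, fun i => cutFragment_subset s.F j x i,
    fun g => ⟨g.frag.cutFragment j x, hne, fun v hv => g.valuation v (hV hv)⟩⟩

/-- Knowledge only grows and fragments are only refined, so facts established at an earlier stage
can be carried over to any later one. -/
lemma Reach.extends {Q : Stage n m → Prop} {s : Stage n m} (h : Reach Q s) :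
    Reach (fun s' => Q s' ∧ s'.Extends s) s := by
  induction h with
  | done h => exact .done ⟨h, .refl _⟩
  | query q j _ ih =>
    exact .query q j fun r hr => (ih r hr).bind fun s' hs' => .done ⟨hs'.1, hs'.2.trans
      ⟨sep_subset _ _, fun j => ⟨j, subset_rfl⟩,
        fun g => ⟨g.frag, hr, fun v hv => g.valuation v hv.1⟩⟩⟩
  | @cut s b q j t hb _ ih =>
    exact .cut b q j t hb fun x hx => (ih x hx).bind fun s' hs' => .done ⟨hs'.1, hs'.2.trans
      (s.extends_cut j x _ (sep_subset _ _) hx b)⟩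
  | drop a b c ha hc _ ih =>
    exact .drop a b c ha hc <| ih.bind fun s' hs' => .done ⟨hs'.1, hs'.2.trans
      ⟨subset_rfl, fun j => ⟨j, subset_rfl⟩, fun g => ⟨g.frag, g.nonempty, g.valuation⟩⟩⟩
  | regroup G S C P c hG hL hv hc _ ih =>
    exact .regroup G S C P c hG hL hv hc <| ih.bind fun s' hs' => .done ⟨hs'.1, hs'.2.trans
      ⟨subset_rfl, fun j => ⟨j, subset_rfl⟩, fun g => ⟨g.frag, g.nonempty, g.valuation⟩⟩⟩

/-- Reach a stage, and go on from there. -/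
lemma Reach.andThen {Q Q' : Stage n m → Prop} {s : Stage n m} (h : Reach Q s)
    (h' : ∀ s', Q s' → s'.Extends s → Reach Q' s') : Reach Q' s :=
  h.extends.bind fun s' hs' => h' s' hs'.1 hs'.2

/-! ### Observers -/

lemma prefix_cons_cases {α : Type*} {g : List α} {s t : α} {h : List α}
    (H : (g ++ [s]) <+: (t :: h)) : (g = [] ∧ s = t) ∨ ∃ g', g = t :: g' ∧ (g' ++ [s]) <+: h := by
  cases g with
  | nil => exact Or.inl ⟨rfl, (List.cons_prefix_cons.1 H).1⟩
  | cons u g' =>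
    obtain ⟨rfl, H'⟩ := List.cons_prefix_cons.1 H
    exact Or.inr ⟨g', rfl, H'⟩

lemma counterWorks_nil (obs : Observer n) : CounterWorks obs [] := by
  intro g s h
  simp at h

lemma CounterWorks.cons {obs : Observer n} {t : Step n} {h : List (Step n)}
    (h₀ : match t with
      | .cutAt _ => obs [t] < obs []
      | _ => obs [t] = obs [])
    (h₁ : CounterWorks (fun g => obs (t :: g)) h) : CounterWorks obs (t :: h) := by
  intro g s H
  rcases prefix_cons_cases H with ⟨rfl, rfl⟩ | ⟨g', rfl, H'⟩
  · exact h₀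
  · exact h₁ g' s H'

lemma omegaCount_nil (obs : Observer n) : omegaCount obs [] = 0 := by
  simp [omegaCount]

open Classical in
lemma omegaCount_cons (obs : Observer n) (t : Step n) (h : List (Step n)) :
    omegaCount obs (t :: h) =
      (if obs [t] / Ordinal.omega0 < obs [] / Ordinal.omega0 then 1 else 0) +
        omegaCount (fun g => obs (t :: g)) h := by
  unfold omegaCount
  rw [List.length_cons, Finset.range_add_one', Finset.filter_insert, Finset.filter_map]
  simp only [List.take_zero, zero_add, List.take_succ_cons]
  split_ifs with h₀
  · rw [Finset.card_insert_of_notMem (by simp), Finset.card_map, add_comm]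
    rfl
  · rw [Finset.card_map, zero_add]
    rfl

/-- The effect of a step on the groups. -/
def stepGroups (L : Finset (Finset (Fin n))) (s : Step n) : Finset (Finset (Fin n)) :=
  match s with
  | .regroup G S _ _ => insert S (insert (G \ S) (L.erase G))
  | _ => L

/-- Like `PartitionsGenuine`, with the groups `L` at the beginning. -/
def PartitionsGenuineFrom (L : Finset (Finset (Fin n))) (v : Player n m → Measure Cake)
    (h : List (Step n)) : Prop :=
  ∀ (g : List (Step n)) (G S : Finset (Fin n)) (C P : Set Cake),
    (g ++ [Step.regroup G S C P]) <+: h →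
      G ∈ g.foldl stepGroups L ∧ 3 ≤ G.card ∧ IsControversial v G S C P

lemma partitionsGenuineFrom_univ {v : Player n m → Measure Cake} {h : List (Step n)}
    (H : PartitionsGenuineFrom {Finset.univ} v h) : PartitionsGenuine v h := H

lemma partitionsGenuineFrom_nil (L : Finset (Finset (Fin n))) (v : Player n m → Measure Cake) :
    PartitionsGenuineFrom L v [] := by
  intro g G S C P h
  simp at h

lemma PartitionsGenuineFrom.cons {L : Finset (Finset (Fin n))} {v : Player n m → Measure Cake}
    {t : Step n} {h : List (Step n)}
    (h₀ : ∀ G S C P, t = .regroup G S C P → G ∈ L ∧ 3 ≤ G.card ∧ IsControversial v G S C P)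
    (h₁ : PartitionsGenuineFrom (stepGroups L t) v h) : PartitionsGenuineFrom L v (t :: h) := by
  intro g G S C P H
  rcases prefix_cons_cases H with ⟨rfl, rfl⟩ | ⟨g', rfl, H'⟩
  · exact h₀ _ _ _ _ rfl
  · exact h₁ g' G S C P H'

lemma FollowsRule.tail {σ : PartitionRule n} {t : Step n} {h : List (Step n)}
    (H : FollowsRule σ (t :: h)) : FollowsRule σ h :=
  fun G S C P hG hm => H G S C P hG (List.mem_cons_of_mem _ hm)

/-- The observer who holds the counter `ζ` at first, and acts like `obs t` after the first step `t`. -/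
def branch (ζ : Ordinal.{0}) (obs : Step n → Observer n) : Observer n
  | [] => ζ
  | t :: h => obs t h

lemma omega_div (A B : ℕ) :
    (Ordinal.omega0 * (A : Ordinal.{0}) + (B : Ordinal.{0})) / Ordinal.omega0 = A := by
  rw [Ordinal.mul_add_div _ Ordinal.omega0_ne_zero,
    Ordinal.div_eq_zero_of_lt (Ordinal.natCast_lt_omega0 B), add_zero]

lemma omega_lt {a b A B : ℕ} (h : a < A ∨ a = A ∧ b < B) :
    Ordinal.omega0 * (a : Ordinal.{0}) + (b : Ordinal.{0}) < Ordinal.omega0 * A + B := by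
  rcases h with h | ⟨rfl, h⟩
  · calc Ordinal.omega0 * (a : Ordinal.{0}) + (b : Ordinal.{0})
        < Ordinal.omega0 * a + Ordinal.omega0 :=
          (add_lt_add_iff_left _).2 (Ordinal.natCast_lt_omega0 b)
      _ = Ordinal.omega0 * ((a + 1 : ℕ) : Ordinal.{0}) := by
          push_cast
          rw [mul_add, mul_one]
      _ ≤ Ordinal.omega0 * A := mul_le_mul_right (by exact_mod_cast h) _
      _ ≤ _ := le_self_add
  · exact (add_lt_add_iff_left _).2 (by exact_mod_cast h)

/-! ### From reachability to protocols with observers -/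

/-- What is required of a protocol for the valuation `v`, when the remaining budget for
`ω`s is `c`. -/
def Meets (Post : (Player n m → Measure Cake) → (Fin n → Set Cake) → Prop) {k : ℕ}
    (F : Fin k → Set Cake) (L : Finset (Finset (Fin n))) (c : PartitionRule n → ℕ)
    (p : Protocol n m k) (obs : Observer n) (v : Player n m → Measure Cake) : Prop :=
  (∃ h X, IsRun v p F h X) ∧ ∀ h X, IsRun v p F h X →
    Post v X ∧ CounterWorks obs h ∧ PartitionsGenuineFrom L v h ∧
      ∀ σ : PartitionRule n, FollowsRule σ h → omegaCount obs h ≤ c σ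

/-- Fragments can be given to the `A`-players such that `Post` holds. -/
def CanFinish (Post : (Player n m → Measure Cake) → (Fin n → Set Cake) → Prop)
    (s : Stage n m) : Prop :=
  ∃ owner : Fin s.k → Fin n, ∀ v ∈ s.V,
    Post v fun a => unionOf s.F (Finset.univ.filter fun j => owner j = a)

/-- A `drop` is not a step of the protocol, since the counter may change only at cuts. So the
counter `ω * A + B` may lag behind the budget of the stage, and it catches up at the next cut. The
summand `if s.a < A then 1 else 0` is the single `ω` that this pending fall uses up, however many
drops preceded it. -/
theorem Reach.exists_protocol [Nonempty (Fin n)]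
    {Post : (Player n m → Measure Cake) → (Fin n → Set Cake) → Prop}
    {s : Stage n m} (hs : Reach (CanFinish Post) s) :
    s.Good → ∀ A B : ℕ, (s.a < A ∨ s.a = A ∧ s.b ≤ B) →
      ∃ (p : Protocol n m s.k) (obs : Observer n),
        obs [] = Ordinal.omega0 * (A : Ordinal.{0}) + B ∧
        ∀ v ∈ s.V, Meets Post s.F s.L (fun σ => s.c σ + if s.a < A then 1 else 0) p obs v := by
  induction hs with
  | @done s h =>
    intro _ A B _
    obtain ⟨owner, h⟩ := h
    refine ⟨.assign owner, fun _ => Ordinal.omega0 * A + B, rfl, fun v hv => ⟨⟨[], _, rfl, rfl⟩, ?_⟩⟩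
    rintro _ _ ⟨rfl, rfl⟩
    exact ⟨h v hv, counterWorks_nil _, partitionsGenuineFrom_nil _ _,
      fun σ _ => by simp [omegaCount_nil]⟩
  | @query s q j _ ih =>
    intro hg A B hAB
    have : ∀ r : ℝ, ∃ (p : Protocol n m s.k) (obs : Observer n),
        obs [] = Ordinal.omega0 * (A : Ordinal.{0}) + B ∧
        ∀ v ∈ s.V, (v q).real (s.F j) = r →
          Meets Post s.F s.L (fun σ => s.c σ + if s.a < A then 1 else 0) p obs v := by
      intro r
      by_cases hr : {v ∈ s.V | (v q).real (s.F j) = r}.Nonempty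
      · obtain ⟨p, obs, h, h'⟩ := ih r hr ⟨hg.frag, hr, fun v hv => hg.valuation v hv.1⟩ A B hAB
        exact ⟨p, obs, h, fun v hv hvr => h' v ⟨hv, hvr⟩⟩
      -- No compatible valuation gives this answer, so any continuation will do.
      · exact ⟨.assign fun _ => Classical.arbitrary _, fun _ => Ordinal.omega0 * A + B, rfl,
          fun v hv hvr => absurd ⟨v, hv, hvr⟩ hr⟩
    choose p obs hobs hmeets using this
    -- The default observer is irrelevant, as a query is always followed by an answer.
    refine ⟨.query q j p, branch (Ordinal.omega0 * A + B) fun t => match t with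
      | .answer r => obs r
      | _ => fun _ => 0, rfl, fun v hv => ?_⟩
    obtain ⟨⟨h, X, hrun⟩, hall⟩ := hmeets _ v hv rfl
    refine ⟨⟨_, X, h, rfl, hrun⟩, ?_⟩
    rintro _ X' ⟨h', rfl, hrun'⟩
    obtain ⟨h₁, h₂, h₃, h₄⟩ := hall h' X' hrun'
    refine ⟨h₁, .cons (hobs _) h₂, .cons (by simp) h₃, fun σ hσ => ?_⟩
    rw [omegaCount_cons]
    simp only [branch, hobs, lt_self_iff_false, if_false, zero_add]
    exact h₄ σ hσ.tail
  | @cut s b q j t hb _ ih =>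
    intro hg A B hAB
    have : ∀ x : Cake, ∃ (p : Protocol n m (s.k + 1)) (obs : Observer n),
        obs [] = Ordinal.omega0 * (s.a : Ordinal.{0}) + b ∧
        ∀ v ∈ s.V, (v q).real (s.F j ∩ Iic x) = (t : ℝ) * (v q).real (s.F j) →
          Meets Post (cutFragment s.F j x) s.L s.c p obs v := by
      intro x
      by_cases hx : {v ∈ s.V |
          (v q).real (s.F j ∩ Iic x) = (t : ℝ) * (v q).real (s.F j)}.Nonempty
      · obtain ⟨p, obs, h, h'⟩ := ih x hx ((s.extends_cut j x _ (sep_subset _ _) hx b).good hg)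
          s.a b (Or.inr ⟨rfl, le_rfl⟩)
        exact ⟨p, obs, h, fun v hv hvr => by simpa using h' v ⟨hv, hvr⟩⟩
      · exact ⟨.assign fun _ => Classical.arbitrary _, fun _ => Ordinal.omega0 * s.a + b, rfl,
          fun v hv hvr => absurd ⟨v, hv, hvr⟩ hx⟩
    choose p obs hobs hmeets using this
    refine ⟨.cut q j t p, branch (Ordinal.omega0 * A + B) fun t => match t with
      | .cutAt x => obs x
      | _ => fun _ => 0, rfl, fun v hv => ?_⟩
    constructor
    · obtain ⟨x, hx⟩ := exists_cut (v q) (hg.valuation v hv q) (hg.frag.measurable j) t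
      obtain ⟨⟨h, X, hrun⟩, -⟩ := hmeets x v hv hx
      exact ⟨_, X, x, h, hx, rfl, hrun⟩
    · rintro _ X' ⟨x, h', hx, rfl, hrun'⟩
      obtain ⟨h₁, h₂, h₃, h₄⟩ := (hmeets x v hv hx).2 h' X' hrun'
      refine ⟨h₁, .cons ?_ h₂, .cons (by simp) h₃, fun σ hσ => ?_⟩
      · change obs x [] < Ordinal.omega0 * A + B
        rw [hobs]
        exact omega_lt (by omega)
      · rw [omegaCount_cons]
        -- The cut lowers the coefficient of `ω` from `A` to `s.a`; this counts exactly if a fall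
        -- was pending.
        simp only [branch, hobs, omega_div, Nat.cast_lt]
        have := h₄ σ hσ.tail
        change omegaCount (obs x) h' ≤ _ at this
        exact (add_comm _ _).trans_le (Nat.add_le_add_right this _)
  | @drop s a b c ha hc _ ih =>
    intro hg A B hAB
    have haA : a < A := by omega
    obtain ⟨p, obs, h, h'⟩ := ih ⟨hg.frag, hg.nonempty, hg.valuation⟩ A B (Or.inl haA)
    refine ⟨p, obs, h, fun v hv => ⟨(h' v hv).1, fun g X hrun => ?_⟩⟩
    obtain ⟨h₁, h₂, h₃, h₄⟩ := (h' v hv).2 g X hrun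
    refine ⟨h₁, h₂, h₃, fun σ hσ => (h₄ σ hσ).trans ?_⟩
    simp only [haA, if_true]
    exact (hc σ).trans (Nat.le_add_right _ _)
  | @regroup s G S C P c hG hL hv hc _ ih =>
    intro hg A B hAB
    obtain ⟨p, obs, hobs, h'⟩ := ih ⟨hg.frag, hg.nonempty, hg.valuation⟩ A B hAB
    refine ⟨.regroup G S C P p, branch (Ordinal.omega0 * A + B) fun _ => obs, rfl,
      fun v hv' => ?_⟩
    obtain ⟨⟨h, X, hrun⟩, hall⟩ := h' v hv'
    refine ⟨⟨_, X, h, rfl, hrun⟩, ?_⟩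
    rintro _ X' ⟨h', rfl, hrun'⟩
    obtain ⟨h₁, h₂, h₃, h₄⟩ := hall h' X' hrun'
    refine ⟨h₁, .cons hobs h₂, .cons ?_ h₃, fun σ hσ => ?_⟩
    · intro G' S' C' P' e
      cases e
      exact ⟨hL, hG, hv v hv'⟩
    · rw [omegaCount_cons]
      simp only [branch, hobs, lt_self_iff_false, if_false, zero_add]
      -- The new budget is compared with the old one only for rules that prescribe this partition;
      -- no other rule is followed any more.
      exact (h₄ σ hσ.tail).trans
        (Nat.add_le_add_right (hc σ (hσ G S _ _ hG List.mem_cons_self)) _)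

/-! ### Rounding -/

/-- If each of the items `j ∈ s` is assigned one of several vectors with weighted mean zero, then
this can be done with a small sum. -/
lemma exists_choice_sum_sq_le {J ι κ : Type*} [Fintype ι] [Fintype κ] [Nonempty ι]
    (s : Finset J) (θ : J → ι → ℝ) (u : J → ι → κ → ℝ) (B : J → ℝ)
    (hθ : ∀ j ∈ s, ∀ c, 0 ≤ θ j c) (hθ₁ : ∀ j ∈ s, ∑ c, θ j c = 1)
    (hu : ∀ j ∈ s, ∀ x, ∑ c, θ j c * u j c x = 0)
    (hB : ∀ j ∈ s, ∀ c, ∑ x, u j c x ^ 2 ≤ B j) :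
    ∃ f : J → ι, ∑ x, (∑ j ∈ s, u j (f j) x) ^ 2 ≤ ∑ j ∈ s, B j := by
  classical
  induction s using Finset.induction_on with
  | empty => exact ⟨fun _ => Classical.arbitrary ι, by simp⟩
  | insert j s hj ih =>
    obtain ⟨f, hf⟩ := ih (fun i hi => hθ i (Finset.mem_insert_of_mem hi))
      (fun i hi => hθ₁ i (Finset.mem_insert_of_mem hi))
      (fun i hi => hu i (Finset.mem_insert_of_mem hi))
      (fun i hi => hB i (Finset.mem_insert_of_mem hi))
    have hj' := Finset.mem_insert_self j s
    set E : κ → ℝ := fun x => ∑ j ∈ s, u j (f j) x with hE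
    -- This is the method of conditional expectations: the cross terms average to zero, so second
    -- moments add up, and some choice does at least as well as the average.
    have hmean : ∑ c, θ j c * ∑ x, (u j c x + E x) ^ 2 ≤ ∑ c, θ j c * (B j + ∑ x, E x ^ 2) := by
      have h₁ : ∑ c, θ j c * ∑ x, (u j c x + E x) ^ 2 =
          ∑ c, θ j c * (∑ x, u j c x ^ 2 + ∑ x, E x ^ 2) +
            ∑ x, 2 * E x * ∑ c, θ j c * u j c x := by
        simp_rw [Finset.mul_sum]
        rw [Finset.sum_comm (s := (Finset.univ : Finset κ)), ← Finset.sum_add_distrib]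
        refine Finset.sum_congr rfl fun c _ => ?_
        rw [mul_add, Finset.mul_sum, Finset.mul_sum, ← Finset.sum_add_distrib,
          ← Finset.sum_add_distrib]
        refine Finset.sum_congr rfl fun x _ => ?_
        ring
      rw [h₁]
      simp only [hu j hj', mul_zero, Finset.sum_const_zero, add_zero]
      exact Finset.sum_le_sum fun c _ => mul_le_mul_of_nonneg_left
        (add_le_add_left (hB j hj' c) _) (hθ j hj' c)
    have hex : ∃ c, ∑ x, (u j c x + E x) ^ 2 ≤ B j + ∑ x, E x ^ 2 := by
      by_contra! hcon
      obtain ⟨c₀, hc₀⟩ : ∃ c, 0 < θ j c := by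
        by_contra! h0
        have := hθ₁ j hj'
        rw [Finset.sum_eq_zero fun c _ => le_antisymm (h0 c) (hθ j hj' c)] at this
        exact zero_ne_one this
      refine absurd hmean (not_le.2 ?_)
      exact Finset.sum_lt_sum (fun c _ => mul_le_mul_of_nonneg_left (hcon c).le (hθ j hj' c))
        ⟨c₀, Finset.mem_univ _, mul_lt_mul_of_pos_left (hcon c₀) hc₀⟩
    obtain ⟨c, hc⟩ := hex
    refine ⟨Function.update f j c, ?_⟩
    have h₂ : ∀ x, ∑ i ∈ insert j s, u i (Function.update f j c i) x = u j c x + E x := by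
      intro x
      rw [Finset.sum_insert hj, Function.update_self, hE]
      congr 1
      refine Finset.sum_congr rfl fun i hi => ?_
      rw [Function.update_of_ne (by rintro rfl; exact hj hi)]
    simp_rw [h₂]
    rw [Finset.sum_insert hj]
    exact hc.trans (add_le_add_right hf _)

lemma abs_le_of_sum_sq_le {κ : Type*} [Fintype κ] {f : κ → ℝ} {η : ℝ} (hη : 0 ≤ η)
    (h : ∑ x, f x ^ 2 ≤ η ^ 2) (x : κ) : |f x| ≤ η :=
  abs_le_of_sq_le_sq' ((Finset.single_le_sum (fun y _ => sq_nonneg (f y))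
    (Finset.mem_univ x)).trans h) hη |> abs_le.2

/-- Choose small items such that their weight is close to a weighted sum of all items, for each of
finitely many players. -/
lemma exists_subset_near {J Q : Type*} [Fintype Q] (s : Finset J) (w : Q → J → ℝ) (τ : J → ℝ)
    {δ η : ℝ} (hη : 0 ≤ η) (hδ : Fintype.card Q * δ ≤ η ^ 2) (h0δ : 0 ≤ δ)
    (hτ : ∀ j, 0 ≤ τ j ∧ τ j ≤ 1)
    (hw : ∀ q, ∀ j ∈ s, 0 ≤ w q j ∧ w q j ≤ δ) (hw₁ : ∀ q, ∑ j ∈ s, w q j ≤ 1) :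
    ∃ D ⊆ s, ∀ q, |∑ j ∈ D, w q j - ∑ j ∈ s, τ j * w q j| ≤ η := by
  classical
  -- Item `j` is taken with probability `τ j`. Its deviation for `q` is at most `w q j`, whose
  -- square is at most `δ * w q j`; summed over all items and players this is at most `|Q| * δ`.
  obtain ⟨f, hf⟩ := exists_choice_sum_sq_le (ι := Bool) (κ := Q) s
    (fun j c => if c then τ j else 1 - τ j)
    (fun j c q => ((if c then 1 else 0) - τ j) * w q j) (fun j => ∑ q, δ * w q j)
    (by
      intro j _ c
      cases c
      · simpa using (hτ j).2
      · simpa using (hτ j).1)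
    (by intro j _; simp)
    (by intro j _ q; simp; ring)
    (by
      intro j hj c
      refine Finset.sum_le_sum fun q _ => ?_
      obtain ⟨h0, h1⟩ := hw q j hj
      have h2 : ((if c then 1 else 0) - τ j) ^ 2 ≤ (1 : ℝ) := by
        obtain ⟨h3, h4⟩ := hτ j
        cases c <;> simp <;> rw [abs_le] <;> constructor <;> linarith
      rw [mul_pow]
      calc _ ≤ 1 * w q j ^ 2 := mul_le_mul_of_nonneg_right h2 (sq_nonneg _)
        _ = w q j * w q j := by ring
        _ ≤ δ * w q j := mul_le_mul_of_nonneg_right h1 h0)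
  refine ⟨s.filter fun j => f j = true, Finset.filter_subset _ _, fun q => ?_⟩
  have h₁ : ∑ j ∈ s, ∑ q, δ * w q j ≤ η ^ 2 := by
    rw [Finset.sum_comm]
    calc ∑ q, ∑ j ∈ s, δ * w q j ≤ ∑ _q : Q, δ := by
          refine Finset.sum_le_sum fun q _ => ?_
          rw [← Finset.mul_sum]
          exact mul_le_of_le_one_right h0δ (hw₁ q)
      _ ≤ η ^ 2 := by simpa using hδ
  have h₂ := abs_le_of_sum_sq_le hη (hf.trans h₁) q
  convert h₂ using 2
  rw [Finset.sum_filter, ← Finset.sum_sub_distrib]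
  refine Finset.sum_congr rfl fun j _ => ?_
  split_ifs <;> ring

/-- If small items are divided into `N` parts each, then the parts can be permuted cyclically such
that, for each of finitely many players, the `i`-th parts are together worth about `1 / N` of
everything. -/
lemma exists_shift_near {J Q : Type*} [Fintype Q] {N : ℕ} [NeZero N] (s : Finset J)
    (w : Q → J → Fin N → ℝ) {δ η : ℝ} (hη : 0 ≤ η) (hδ : Fintype.card Q * δ ≤ η ^ 2)
    (h0δ : 0 ≤ δ) (hw : ∀ q, ∀ j ∈ s, ∀ i, 0 ≤ w q j i)
    (hwδ : ∀ q, ∀ j ∈ s, ∑ i, w q j i ≤ δ) (hw₁ : ∀ q, ∑ j ∈ s, ∑ i, w q j i ≤ 1) :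
    ∃ f : J → Fin N, ∀ q i,
      |∑ j ∈ s, w q j (i + f j) - (∑ j ∈ s, ∑ i, w q j i) / N| ≤ η := by
  have hN : (N : ℝ) ≠ 0 := Nat.cast_ne_zero.2 (NeZero.ne N)
  -- Each item receives a uniformly random shift, under which every position has the mean `W / N`.
  -- The squared deviations add up to at most `∑ w ^ 2 ≤ W ^ 2 ≤ δ * W`.
  obtain ⟨f, hf⟩ := exists_choice_sum_sq_le (ι := Fin N) (κ := Q × Fin N) s
    (fun _ _ => (N : ℝ)⁻¹) (fun j c x => w x.1 j (x.2 + c) - (∑ i, w x.1 j i) / N)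
    (fun j => ∑ q, δ * ∑ i, w q j i)
    (fun _ _ _ => by positivity)
    (fun _ _ => by simp [hN])
    (by
      rintro j _ ⟨q, i⟩
      rw [← Finset.mul_sum, Finset.sum_sub_distrib,
        Fintype.sum_equiv (Equiv.addLeft i) (fun c => w q j (i + c)) (w q j) fun _ => rfl]
      simp only [Finset.sum_const, Finset.card_univ, Fintype.card_fin, nsmul_eq_mul]
      field_simp
      ring)
    (by
      intro j hj c
      rw [Fintype.sum_prod_type]
      refine Finset.sum_le_sum fun q _ => ?_
      dsimp only
      set W := ∑ i, w q j i with hW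
      rw [Fintype.sum_equiv (Equiv.addRight c) (fun i => (w q j (i + c) - W / N) ^ 2)
        (fun i => (w q j i - W / N) ^ 2) fun _ => rfl]
      have h0 : 0 ≤ W := Finset.sum_nonneg fun i _ => hw q j hj i
      have h1 : ∑ i, (w q j i - W / N) ^ 2 = ∑ i, w q j i ^ 2 - W ^ 2 / N := by
        have : ∀ i, (w q j i - W / N) ^ 2 = w q j i ^ 2 - 2 * (W / N) * w q j i + (W / N) ^ 2 :=
          fun i => by ring
        simp_rw [this]
        rw [Finset.sum_add_distrib, Finset.sum_sub_distrib, ← Finset.mul_sum, ← hW]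
        simp only [Finset.sum_const, Finset.card_univ, Fintype.card_fin, nsmul_eq_mul]
        field_simp
        ring
      have h2 : ∑ i, w q j i ^ 2 ≤ W * W := by
        rw [hW, Finset.sum_mul]
        refine Finset.sum_le_sum fun i _ => ?_
        rw [sq]
        exact mul_le_mul_of_nonneg_left (Finset.single_le_sum (fun i _ => hw q j hj i)
          (Finset.mem_univ i)) (hw q j hj i)
      have h3 : 0 ≤ W ^ 2 / N := by positivity
      have h4 := mul_le_mul_of_nonneg_right (hwδ q j hj) h0
      rw [h1]
      linarith)
  have h₁ : ∑ j ∈ s, ∑ q, δ * ∑ i, w q j i ≤ η ^ 2 := by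
    rw [Finset.sum_comm]
    calc ∑ q, ∑ j ∈ s, δ * ∑ i, w q j i ≤ ∑ _q : Q, δ := by
          refine Finset.sum_le_sum fun q _ => ?_
          rw [← Finset.mul_sum]
          exact mul_le_of_le_one_right h0δ (hw₁ q)
      _ ≤ η ^ 2 := by simpa using hδ
  refine ⟨f, fun q i => ?_⟩
  have h₂ := abs_le_of_sum_sq_le hη (hf.trans h₁) (q, i)
  convert h₂ using 2
  rw [Finset.sum_sub_distrib, Finset.sum_div]

/-! ### Refining all fragments -/

/-- The stages differ at most in the fragments, the knowledge and the number of cuts left. -/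
structure Stage.SameBudget (s' s : Stage n m) : Prop where
  a : s'.a = s.a
  c : s'.c = s.c
  L : s'.L = s.L

lemma Stage.SameBudget.refl (s : Stage n m) : s.SameBudget s := ⟨rfl, rfl, rfl⟩

lemma Stage.SameBudget.trans {s₁ s₂ s₃ : Stage n m} (h : s₃.SameBudget s₂)
    (h' : s₂.SameBudget s₁) : s₃.SameBudget s₁ :=
  ⟨h.a.trans h'.a, h.c.trans h'.c, h.L.trans h'.L⟩

/-- The piece `C` is known to be a union of `N` disjoint pieces of the same value to `q`. -/
def Stage.EqualParts (s : Stage n m) (q : Player n m) (N : ℕ) (C : Set Cake) : Prop :=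
  ∃ Y : Fin N → Set Cake, (∀ i, Adapted s.F (Y i)) ∧ (Pairwise fun i j => Disjoint (Y i) (Y j)) ∧
    ⋃ i, Y i = C ∧ ∀ v ∈ s.V, ∀ i, (v q).real (Y i) = (v q).real C / N

lemma Stage.EqualParts.extends {s s' : Stage n m} {q : Player n m} {N : ℕ} {C : Set Cake}
    (h : s.EqualParts q N C) (hs : s'.Extends s) : s'.EqualParts q N C := by
  obtain ⟨Y, h₁, h₂, h₃, h₄⟩ := h
  exact ⟨Y, fun i => (h₁ i).refine hs.refines, h₂, h₃, fun v hv => h₄ v (hs.subset hv)⟩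

/-- The first cut leaves the last of the equal parts on the right. The left part keeps the number
`j` and is split further by induction. The other fragments keep their numbers, so that fragments can
be treated one after another. -/
lemma reach_split_fragment (q : Player n m) (N : ℕ) : ∀ (s : Stage n m) (j : Fin s.k) (b : ℕ),
    s.Good → s.b = b + N → Reach (fun s' => s'.SameBudget s ∧ s'.b = b ∧ s'.k = s.k + N ∧
      (∀ i : Fin s.k, i ≠ j → ∃ h : i.1 < s'.k, s'.F ⟨i.1, h⟩ = s.F i) ∧
      s'.EqualParts q (N + 1) (s.F j)) s := by
  induction N with
  | zero =>
    intro s j b hg hb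
    refine .done ⟨.refl s, hb, rfl, fun i _ => ⟨i.2, rfl⟩, fun _ => s.F j,
      fun _ => hg.frag.adapted_fragment j, fun i i' h => absurd (Fin.ext (by omega)) h,
      iUnion_const _, fun v _ i => by simp⟩
  | succ N ih =>
    intro s j b hg hb
    -- Here `N + 1` cuts must produce `N + 2` parts, all but one of which come from the left side.
    have ht : (N + 1 : ℝ) / (N + 2) ∈ unitInterval :=
      ⟨by positivity, (div_le_one (by positivity)).2 (by linarith)⟩
    refine .cut (b + N) q j ⟨_, ht⟩ (by omega) fun x hx => ?_
    set s₁ : Stage n m := { s with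
      k := s.k + 1
      F := cutFragment s.F j x
      V := {v ∈ s.V | (v q).real (s.F j ∩ Iic x) =
        ((⟨_, ht⟩ : unitInterval) : ℝ) * (v q).real (s.F j)}
      b := b + N } with hs₁
    have hext : s₁.Extends s := s.extends_cut j x _ (sep_subset _ _) hx _
    refine (ih s₁ j.castSucc b (hext.good hg) rfl).andThen fun s' hs' hext' => .done ?_
    obtain ⟨h₁, h₂, h₃, h₄, Y, h₅, h₆, h₇, h₈⟩ := hs'
    have hleft : s₁.F j.castSucc = s.F j ∩ Iic x := cutFragment_castSucc_self _ _ _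
    have hright : s₁.F (Fin.last s.k) = s.F j ∩ Ioi x := cutFragment_last _ _ _
    have hYsub : ∀ i, Y i ⊆ s.F j ∩ Iic x := fun i => by
      rw [← hleft, ← h₇]
      exact subset_iUnion Y i
    have hdis : ∀ i, Disjoint (Y i) (s.F j ∩ Ioi x) := fun i =>
      disjoint_left.2 fun y hy hy' => not_lt.2 (mem_Iic.1 (hYsub i hy).2) (mem_Ioi.1 hy'.2)
    refine ⟨h₁.trans ⟨rfl, rfl, rfl⟩, h₂, ?_, fun i hi => ?_,
      Fin.snoc (α := fun _ => Set Cake) Y (s.F j ∩ Ioi x), ?_, ?_, ?_, ?_⟩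
    · rw [h₃]
      change s.k + 1 + N = _
      omega
    · obtain ⟨h, h'⟩ := h₄ i.castSucc fun e => hi (Fin.castSucc_injective _ e)
      exact ⟨h, h'.trans (cutFragment_castSucc_of_ne s.F hi x)⟩
    · intro i
      induction i using Fin.lastCases with
      | last =>
        rw [Fin.snoc_last, ← hright]
        exact ((hext.good hg).frag.adapted_fragment _).refine hext'.refines
      | cast i => rw [Fin.snoc_castSucc]; exact h₅ i
    · intro i i' h
      induction i using Fin.lastCases with
      | last =>
        induction i' using Fin.lastCases with
        | last => exact absurd rfl h
        | cast i' => rw [Fin.snoc_castSucc, Fin.snoc_last]; exact (hdis i').symm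
      | cast i =>
        induction i' using Fin.lastCases with
        | last => rw [Fin.snoc_castSucc, Fin.snoc_last]; exact hdis i
        | cast i' =>
          rw [Fin.snoc_castSucc, Fin.snoc_castSucc]
          exact h₆ fun e => h (congrArg Fin.castSucc e)
    · have hu : s.F j = (s.F j ∩ Iic x) ∪ (s.F j ∩ Ioi x) := by
        rw [← inter_union_distrib_left, Iic_union_Ioi, inter_univ]
      rw [hu, ← hleft, ← h₇]
      ext y
      simp only [mem_iUnion, mem_union, Fin.exists_fin_succ', Fin.snoc_castSucc, Fin.snoc_last]
      rw [h₇, hleft, ← hu]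
    · intro v hv i
      have hv₁ := hext'.subset hv
      obtain ⟨_, _⟩ := hg.valuation v hv₁.1 q
      have hcut : (v q).real (s.F j ∩ Iic x) = (N + 1 : ℝ) / (N + 2) * (v q).real (s.F j) := hv₁.2
      induction i using Fin.lastCases with
      | last =>
        rw [Fin.snoc_last]
        have : (v q).real (s.F j) = (v q).real (s.F j ∩ Iic x) + (v q).real (s.F j ∩ Ioi x) := by
          rw [← measureReal_union _ ((hg.frag.measurable j).inter measurableSet_Ioi),
            ← inter_union_distrib_left, Iic_union_Ioi, inter_univ]
          exact (Iic_disjoint_Ioi le_rfl).mono inter_subset_right inter_subset_right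
        rw [hcut] at this
        push_cast
        have h0 : (N : ℝ) + 2 ≠ 0 := by positivity
        have h0' : (N : ℝ) + 1 + 1 ≠ 0 := by positivity
        field_simp at this ⊢
        linarith
      | cast i =>
        rw [Fin.snoc_castSucc, h₈ v hv i, hleft, hcut]
        push_cast
        have h0' : (N : ℝ) + 1 + 1 ≠ 0 := by positivity
        field_simp
        ring

/-- New fragments are numbered at the end, so after the first `i` original fragments have been
split, the remaining ones still carry their old numbers. -/
lemma reach_split_fragments (q : Player n m) (N : ℕ) (s : Stage n m) (hg : s.Good) (i : ℕ) :
    ∀ b : ℕ, i ≤ s.k → s.b = b + i * N → Reach (fun s' => s'.SameBudget s ∧ s'.b = b ∧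
      s'.k = s.k + i * N ∧ (∀ j : Fin s.k, i ≤ j.1 → ∃ h : j.1 < s'.k, s'.F ⟨j.1, h⟩ = s.F j) ∧
      ∀ j : Fin s.k, j.1 < i → s'.EqualParts q (N + 1) (s.F j)) s := by
  induction i with
  | zero =>
    intro b _ hb
    exact .done ⟨.refl s, by simpa using hb, by simp, fun j _ => ⟨j.2, rfl⟩,
      fun j h => absurd h (Nat.not_lt_zero _)⟩
  | succ i ih =>
    intro b hi hb
    refine (ih (b + N) (by omega) (by rw [hb]; ring)).andThen fun s₁ hs₁ hext => ?_
    obtain ⟨h₁, h₂, h₃, h₄, h₅⟩ := hs₁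
    obtain ⟨hlt, hF⟩ := h₄ ⟨i, hi⟩ le_rfl
    refine (reach_split_fragment q N s₁ ⟨i, hlt⟩ b (hext.good hg) h₂).andThen
      fun s₂ hs₂ hext₂ => .done ?_
    obtain ⟨h₁', h₂', h₃', h₄', h₅'⟩ := hs₂
    refine ⟨h₁'.trans h₁, h₂', by rw [h₃', h₃]; ring, fun j hj => ?_, fun j hj => ?_⟩
    · obtain ⟨h, h'⟩ := h₄ j (by omega)
      obtain ⟨h'', h'''⟩ := h₄' ⟨j, h⟩ (by simp only [ne_eq, Fin.mk.injEq]; omega)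
      exact ⟨h'', h'''.trans h'⟩
    · rcases Nat.lt_succ_iff_lt_or_eq.1 hj with hj | hj
      · exact (h₅ j hj).extends hext₂
      · have : j = ⟨i, hi⟩ := Fin.ext hj
        rw [this, ← hF]
        exact h₅'

/-- The player `q` divides every fragment into `N + 1` equal parts. -/
lemma reach_equalParts (q : Player n m) (N : ℕ) (s : Stage n m) (hg : s.Good) (b : ℕ)
    (hb : s.b = b + s.k * N) : Reach (fun s' => s'.SameBudget s ∧ s'.b = b ∧
      s'.k = s.k + s.k * N ∧ ∀ j : Fin s.k, s'.EqualParts q (N + 1) (s.F j)) s :=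
  (reach_split_fragments q N s hg s.k b le_rfl hb).bind fun _ h =>
    .done ⟨h.1, h.2.1, h.2.2.1, fun j => h.2.2.2.2 j j.2⟩

/-- Everybody in `l` divides every fragment into `N + 1` equal parts, with a number of cuts that
is known in advance. -/
lemma reach_small_fragments (l : List (Player n m)) (N : ℕ) : ∀ k : ℕ, ∃ M k' : ℕ,
    ∀ (s : Stage n m) (b : ℕ), s.Good → s.k = k → s.b = b + M →
      Reach (fun s' => s'.SameBudget s ∧ s'.b = b ∧ s'.k = k' ∧
        ∀ q ∈ l, ∀ v ∈ s'.V, ∀ j, (v q).real (s'.F j) ≤ 1 / (N + 1)) s := by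
  induction l with
  | nil => exact fun k => ⟨0, k, fun s b _ hk hb => .done ⟨.refl s, hb, hk, by simp⟩⟩
  | cons q l ih =>
    intro k
    obtain ⟨M, k', h⟩ := ih (k + k * N)
    refine ⟨k * N + M, k', fun s b hg hk hb => ?_⟩
    subst hk
    refine (reach_equalParts q N s hg (b + M) (by omega)).andThen fun s₁ hs₁ hext => ?_
    obtain ⟨h₁, h₂, h₃, h₄⟩ := hs₁
    refine (h s₁ b (hext.good hg) h₃ h₂).andThen fun s₂ hs₂ hext₂ => .done ?_
    obtain ⟨h₁', h₂', h₃', h₄'⟩ := hs₂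
    refine ⟨h₁'.trans h₁, h₂', h₃', ?_⟩
    intro q' hq' v hv j
    rcases List.mem_cons.1 hq' with rfl | hq'
    · obtain ⟨i, hi⟩ := hext₂.refines j
      have hv₁ := hext₂.subset hv
      have hval := hg.valuation v (hext.subset hv₁) q'
      obtain ⟨_, _⟩ := hval
      have hle : (v q').real (s₁.F i) ≤ 1 / (N + 1) := by
        rcases (s₁.F i).eq_empty_or_nonempty with he | ⟨x, hx⟩
        · rw [he]
          simp only [measureReal_empty]
          positivity
        · obtain ⟨l, hl⟩ := hg.frag.cover x
          obtain ⟨Y, hY₁, -, hY₃, hY₄⟩ := h₄ l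
          rw [← hY₃] at hl
          obtain ⟨c, hc⟩ := mem_iUnion.1 hl
          -- A fragment that meets one of the equal parts lies inside it. This needs a point, so
          -- empty fragments were treated separately.
          have hsub := (hY₁ c i).resolve_right fun h => disjoint_left.1 h hx hc
          refine (measureReal_mono hsub).trans ?_
          rw [hY₄ v hv₁ c]
          push_cast
          exact div_le_div_of_nonneg_right measureReal_le_one (by positivity)
      exact (measureReal_mono hi).trans hle
    · exact h₄' q' hq' v hv j

/-! ### Announced values -/

/-- All valuations agree on the values of the fragments. -/
def Stage.ValuesKnown (s : Stage n m) : Prop :=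
  ∀ q, ∀ j, ∀ v ∈ s.V, ∀ v' ∈ s.V, (v q).real (s.F j) = (v' q).real (s.F j)

/-- Each query restricts the compatible valuations to those with the announced value; later
restrictions preserve the agreement. -/
lemma reach_query_list (s : Stage n m) (l : List (Player n m × Fin s.k)) :
    ∀ V : Set (Player n m → Measure Cake), V.Nonempty →
      Reach (fun s' => ∃ V' ⊆ V, s' = { s with V := V' } ∧ ∀ x ∈ l, ∀ v ∈ V', ∀ v' ∈ V',
        (v x.1).real (s.F x.2) = (v' x.1).real (s.F x.2)) { s with V := V } := by
  induction l with
  | nil => exact fun V _ => .done ⟨V, subset_rfl, rfl, by simp⟩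
  | cons x l ih =>
    intro V _
    refine .query x.1 x.2 fun r hr => (ih _ hr).bind fun s' hs' => .done ?_
    obtain ⟨V', hV', rfl, h⟩ := hs'
    refine ⟨V', hV'.trans (sep_subset _ _), rfl, fun y hy v hv v' hv' => ?_⟩
    rcases List.mem_cons.1 hy with rfl | hy
    · exact (hV' hv).2.trans (hV' hv').2.symm
    · exact h y hy v hv v' hv'

/-- Everybody announces the values of all fragments. -/
lemma reach_valuesKnown (s : Stage n m) (hg : s.Good) :
    Reach (fun s' => ∃ V', s' = { s with V := V' } ∧ s'.ValuesKnown) s := by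
  refine (reach_query_list s Finset.univ.toList s.V hg.nonempty).bind fun s' hs' => .done ?_
  obtain ⟨V', -, rfl, h⟩ := hs'
  exact ⟨V', rfl, fun q j v hv v' hv' => h (q, j) (by simp) v hv v' hv'⟩

/-- Decisions can therefore be based on one representative valuation, although the protocol sees
only answers. -/
lemma Stage.ValuesKnown.real_eq {s : Stage n m} (h : s.ValuesKnown) (hg : s.Good)
    {v v' : Player n m → Measure Cake} (hv : v ∈ s.V) (hv' : v' ∈ s.V) (q : Player n m)
    {C : Set Cake} (hC : Adapted s.F C) : (v q).real C = (v' q).real C := by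
  obtain ⟨_, _⟩ := hg.valuation v hv q
  obtain ⟨_, _⟩ := hg.valuation v' hv' q
  rw [hg.frag.measureReal_eq_sum _ hC, hg.frag.measureReal_eq_sum _ hC]
  exact Finset.sum_congr rfl fun j _ => h q j v hv v' hv'

/-- Fragments worth at most `1 / (N + 1)` to each of `Q` players are then small enough for the
rounding lemmas with error `η`. -/
lemma exists_precision (Q : ℕ) {η : ℝ} (hη : 0 < η) : ∃ N : ℕ, Q * (1 / ((N : ℝ) + 1)) ≤ η ^ 2 := by
  obtain ⟨N, hN⟩ := exists_nat_ge (Q / η ^ 2)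
  refine ⟨N, ?_⟩
  have h2 : 0 < η ^ 2 := by positivity
  rw [div_le_iff₀ h2] at hN
  rw [mul_one_div, div_le_iff₀ (by positivity)]
  nlinarith

/-! ### Approximate divisions for the price of one `ω` -/

/-- With one `ω`, the cake can be refined such that arbitrary weighted unions of the old fragments
are approximated by pieces. -/
lemma reach_near_weighted (s : Stage n m) (hg : s.Good) {a : ℕ} {c : PartitionRule n → ℕ}
    (ha : a < s.a) (hc : ∀ σ, c σ + 1 ≤ s.c σ) {η : ℝ} (hη : 0 < η) :
    Reach (fun s' => s'.a = a ∧ s'.c = c ∧ s'.L = s.L ∧ s'.ValuesKnown ∧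
      ∀ P R, Adapted s.F P → Adapted s.F R → Disjoint P R → ∀ θ φ : ℝ, 0 ≤ θ → θ ≤ 1 →
        0 ≤ φ → φ ≤ 1 → ∃ D, Adapted s'.F D ∧ D ⊆ P ∪ R ∧ ∀ v ∈ s'.V, ∀ q,
          |(v q).real D - (θ * (v q).real P + φ * (v q).real R)| ≤ η) s := by
  obtain ⟨N, hN⟩ := exists_precision (Fintype.card (Player n m)) hη
  obtain ⟨M, k', hM⟩ := reach_small_fragments (Finset.univ : Finset (Player n m)).toList N s.k
  -- The number `M` depends on the present number of fragments and on `η`; it becomes the finite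
  -- part of the counter only now.
  refine .drop a (0 + M) c ha hc ?_
  refine (hM { s with a := a, b := 0 + M, c := c } 0
    ⟨hg.frag, hg.nonempty, hg.valuation⟩ rfl rfl).andThen fun s₁ hs₁ hext => ?_
  obtain ⟨h₁, -, -, h₂⟩ := hs₁
  have hg₁ := hext.good ⟨hg.frag, hg.nonempty, hg.valuation⟩
  refine (reach_valuesKnown s₁ hg₁).andThen fun s₂ hs₂ hext₂ => .done ?_
  obtain ⟨V', rfl, hk⟩ := hs₂
  have hg₂ := hext₂.good hg₁
  refine ⟨h₁.a, h₁.c, h₁.L, hk, fun P R hP hR hPR θ φ hθ hθ' hφ hφ' => ?_⟩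
  replace hP : Adapted s₁.F P := hP.refine hext.refines
  replace hR : Adapted s₁.F R := hR.refine hext.refines
  have hPRa : Adapted s₁.F (P ∪ R) := by
    rw [union_eq_iUnion]
    exact Adapted.iUnion fun b => by cases b <;> assumption
  obtain ⟨v₀, hv₀⟩ := hg₂.nonempty
  have hfin : ∀ q, IsProbabilityMeasure (v₀ q) := fun q => (hg₂.valuation v₀ hv₀ q).1
  classical
  obtain ⟨J, hJ, hJ'⟩ := exists_subset_near (Q := Player n m) (fragmentsIn s₁.F P ∪ fragmentsIn s₁.F R)
    (fun q j => (v₀ q).real (s₁.F j)) (fun j => if j ∈ fragmentsIn s₁.F P then θ else φ) hη.le hN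
    (by positivity) (fun j => by split_ifs <;> constructor <;> assumption)
    (fun q j _ => ⟨measureReal_nonneg, h₂ q (by simp) v₀ (hext₂.subset hv₀) j⟩)
    (fun q => by
      have := hfin q
      rw [← hg₁.frag.measureReal_unionOf]
      exact measureReal_le_one)
  refine ⟨unionOf s₁.F J, hg₁.frag.adapted_unionOf J, ?_, fun v hv q => ?_⟩
  · intro x hx
    obtain ⟨j, hj, hx⟩ := mem_unionOf.1 hx
    rcases Finset.mem_union.1 (hJ hj) with h | h
    · exact Or.inl (mem_fragmentsIn.1 h hx)
    · exact Or.inr (mem_fragmentsIn.1 h hx)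
  · have := hfin q
    rw [hk.real_eq hg₂ hv hv₀ q (hg₁.frag.adapted_unionOf J), hk.real_eq hg₂ hv hv₀ q hP,
      hk.real_eq hg₂ hv hv₀ q hR, hg₁.frag.measureReal_unionOf,
      hg₁.frag.measureReal_eq_sum _ hP, hg₁.frag.measureReal_eq_sum _ hR]
    convert hJ' q using 3
    -- The index sets of the disjoint pieces `P` and `R` may overlap, but only in empty fragments.
    have hzero : ∀ j ∈ fragmentsIn s₁.F P, j ∈ fragmentsIn s₁.F R → (v₀ q).real (s₁.F j) = 0 := by
      intro j hj hj'
      rw [subset_empty_iff.1 ((subset_inter (mem_fragmentsIn.1 hj) (mem_fragmentsIn.1 hj')).trans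
        hPR.inter_eq.subset), measureReal_empty]
    have hinter : ∑ j ∈ fragmentsIn s₁.F P ∩ fragmentsIn s₁.F R,
        (if j ∈ fragmentsIn s₁.F P then θ else φ) * (v₀ q).real (s₁.F j) = 0 :=
      Finset.sum_eq_zero fun j hj => by
        rw [hzero j (Finset.mem_inter.1 hj).1 (Finset.mem_inter.1 hj).2, mul_zero]
    rw [← add_zero (∑ j ∈ _ ∪ _, _), ← hinter, Finset.sum_union_inter, Finset.mul_sum,
      Finset.mul_sum]
    congr 1
    · exact Finset.sum_congr rfl fun j hj => by rw [if_pos hj]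
    · refine Finset.sum_congr rfl fun j hj => ?_
      split_ifs with h
      · rw [hzero j h hj, mul_zero, mul_zero]
      · rfl

/-- With one `ω`, every piece can be divided into `N` pieces that are equal for `p` and nearly
equal for everybody. -/
lemma reach_near_equal (s : Stage n m) (hg : s.Good) (p : Player n m) (N : ℕ) {a : ℕ}
    {c : PartitionRule n → ℕ} (ha : a < s.a) (hc : ∀ σ, c σ + 1 ≤ s.c σ) {η : ℝ} (hη : 0 < η) :
    Reach (fun s' => s'.a = a ∧ s'.c = c ∧ s'.L = s.L ∧ s'.ValuesKnown ∧
      ∀ C, Adapted s.F C → ∃ X : Fin (N + 1) → Set Cake, (∀ i, Adapted s'.F (X i)) ∧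
        (Pairwise fun i j => Disjoint (X i) (X j)) ∧ ⋃ i, X i = C ∧ ∀ v ∈ s'.V, ∀ i,
          (v p).real (X i) = (v p).real C / (N + 1 : ℕ) ∧
          ∀ q, |(v q).real (X i) - (v q).real C / (N + 1 : ℕ)| ≤ η) s := by
  obtain ⟨K, hK⟩ := exists_precision (Fintype.card (Player n m)) hη
  obtain ⟨M, k', hM⟩ := reach_small_fragments (Finset.univ : Finset (Player n m)).toList K s.k
  -- After `M` cuts there are `k'` small fragments, and `p` then makes `N` cuts in each of them.
  refine .drop a (0 + k' * N + M) c ha hc ?_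
  refine (hM { s with a := a, b := 0 + k' * N + M, c := c } (0 + k' * N)
    ⟨hg.frag, hg.nonempty, hg.valuation⟩ rfl rfl).andThen fun s₁ hs₁ hext => ?_
  obtain ⟨h₁, hb₁, hk₁, h₂⟩ := hs₁
  have hg₁ := hext.good ⟨hg.frag, hg.nonempty, hg.valuation⟩
  refine (reach_equalParts p N s₁ hg₁ 0 (by rw [hb₁, hk₁])).andThen fun s₂ hs₂ hext₂ => ?_
  obtain ⟨h₁', -, -, hY⟩ := hs₂
  have hg₂ := hext₂.good hg₁
  refine (reach_valuesKnown s₂ hg₂).andThen fun s₃ hs₃ hext₃ => .done ?_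
  obtain ⟨V', rfl, hk⟩ := hs₃
  have hg₃ := hext₃.good hg₂
  have hSame := h₁'.trans h₁
  refine ⟨hSame.a, hSame.c, hSame.L, hk, fun C hC => ?_⟩
  replace hC : Adapted s₁.F C := hC.refine hext.refines
  choose Y hY₁ hY₂ hY₃ hY₄ using hY
  have hYsub : ∀ j i, Y j i ⊆ s₁.F j := fun j i => by
    rw [← hY₃ j]
    exact subset_iUnion (Y j) i
  have hmeas : ∀ j i, MeasurableSet (Y j i) := fun j i => (hY₁ j i).measurableSet hg₂.frag
  obtain ⟨v₀, hv₀⟩ := hg₃.nonempty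
  have hfin : ∀ v ∈ V', ∀ q, IsProbabilityMeasure (v q) := fun v hv q => (hg₃.valuation v hv q).1
  have hsum : ∀ v ∈ V', ∀ q j, ∑ i, (v q).real (Y j i) = (v q).real (s₁.F j) := by
    intro v hv q j
    have := hfin v hv q
    rw [← hY₃ j, measureReal_iUnion_fintype (hY₂ j) (hmeas j)]
  have hsumC : ∀ v ∈ V', ∀ q, ∑ j ∈ fragmentsIn s₁.F C, (v q).real (s₁.F j) = (v q).real C := by
    intro v hv q
    have := hfin v hv q
    rw [hg₁.frag.measureReal_eq_sum _ hC]
  obtain ⟨f, hf⟩ := exists_shift_near (Q := Player n m) (N := N + 1) (fragmentsIn s₁.F C)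
    (fun q j i => (v₀ q).real (Y j i)) hη.le hK (by positivity)
    (fun q j _ i => measureReal_nonneg)
    (fun q j _ => by
      rw [hsum v₀ hv₀]
      exact h₂ q (by simp) v₀ (hext₂.subset (hext₃.subset hv₀)) j)
    (fun q => by
      have := hfin v₀ hv₀ q
      simp_rw [hsum v₀ hv₀]
      rw [hsumC v₀ hv₀]
      exact measureReal_le_one)
  simp_rw [hsum v₀ hv₀, hsumC v₀ hv₀] at hf
  -- The parts of one fragment are all equal for `p`, so shifting them costs `p` nothing; the shifts
  -- `f` serve to balance the pieces for everybody else.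
  set X : Fin (N + 1) → Set Cake := fun i => ⋃ j ∈ fragmentsIn s₁.F C, Y j (i + f j) with hX
  have hXa : ∀ i, Adapted s₂.F (X i) := fun i =>
    Adapted.iUnion fun j => Adapted.iUnion fun _ => hY₁ j _
  have hXv : ∀ v ∈ V', ∀ q i, (v q).real (X i) =
      ∑ j ∈ fragmentsIn s₁.F C, (v q).real (Y j (i + f j)) := by
    intro v hv q i
    have := hfin v hv q
    exact measureReal_biUnion_finset (fun j _ j' _ h =>
      (hg₁.frag.disjoint h).mono (hYsub j _) (hYsub j' _)) fun j _ => hmeas j _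
  refine ⟨X, hXa, fun i i' h => ?_, ?_, fun v hv i => ⟨?_, fun q => ?_⟩⟩
  · simp only [hX, disjoint_iUnion_left, disjoint_iUnion_right]
    intro j' _ j _
    by_cases hjj : j = j'
    · subst hjj
      exact hY₂ _ fun e => h (add_right_cancel e)
    · exact (hg₁.frag.disjoint hjj).mono (hYsub _ _) (hYsub _ _)
  · ext x
    simp only [hX, mem_iUnion, exists_prop]
    constructor
    · rintro ⟨i, j, hj, hx⟩
      exact mem_fragmentsIn.1 hj (hYsub _ _ hx)
    · intro hx
      rw [← hC.unionOf_fragmentsIn hg₁.frag] at hx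
      obtain ⟨j, hj, hx⟩ := mem_unionOf.1 hx
      rw [← hY₃ j] at hx
      obtain ⟨i, hx⟩ := mem_iUnion.1 hx
      exact ⟨i - f j, j, hj, by rwa [sub_add_cancel]⟩
  · rw [hXv v hv, ← hsumC v hv, Finset.sum_div]
    exact Finset.sum_congr rfl fun j _ => hY₄ j v (hext₃.subset hv) _
  · rw [hk.real_eq hg₃ hv hv₀ q (hXa i), hk.real_eq hg₃ hv hv₀ q (hC.refine hext₂.refines),
      hXv v₀ hv₀]
    exact hf q i

/-! ### Exploiting a controversial piece -/

/-- With one `ω`, a controversial piece leads to a division of `C` in a proportion `r : 1 - r` such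
that each of the two groups would have an advantage from its part, and everybody else thinks that
the proportion is nearly as required. -/
lemma reach_advantage (s : Stage n m) (hg : s.Good) (hk : s.ValuesKnown) {G S : Finset (Fin n)}
    {C P : Set Cake} (hC : Adapted s.F C) (hP : Adapted s.F P)
    (hGS : ∀ v ∈ s.V, IsControversial v G S C P) {r : ℝ} (hr : 0 < r) (hr₁ : r < 1)
    {a : ℕ} {c : PartitionRule n → ℕ} (ha : a < s.a) (hc : ∀ σ, c σ + 1 ≤ s.c σ)
    {ε : ℝ} (hε : 0 < ε) :
    Reach (fun s' => s'.a = a ∧ s'.c = c ∧ s'.L = s.L ∧ ∃ (D : Set Cake) (κ : ℝ),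
      0 < κ ∧ Adapted s'.F D ∧ D ⊆ C ∧ ∀ v ∈ s'.V,
        (∀ g ∈ S, r * (v (.inl g)).real C + κ ≤ (v (.inl g)).real D) ∧
        (∀ g ∈ G \ S, (v (.inl g)).real D ≤ r * (v (.inl g)).real C - κ) ∧
        ∀ q, |(v q).real D - r * (v q).real C| ≤ ε) s := by
  obtain ⟨v₀, hv₀⟩ := hg.nonempty
  obtain ⟨hS, hSG, hPC, hpos, α, β, hαβ, hα, hβ⟩ := hGS v₀ hv₀
  have hfin : ∀ v ∈ s.V, ∀ q, IsProbabilityMeasure (v q) := fun v hv q => (hg.valuation v hv q).1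
  have hle : ∀ q, (v₀ q).real P ≤ (v₀ q).real C := fun q => by
    have := hfin v₀ hv₀ q
    exact measureReal_mono hPC
  have hα₁ : α ≤ 1 := by
    obtain ⟨g, hgS⟩ := hS
    have h := hle (.inl g)
    rw [hα g hgS] at h
    exact le_of_mul_le_mul_right (by rwa [one_mul]) (hpos g (hSG.subset hgS))
  have hβ₀ : 0 ≤ β := by
    obtain ⟨g, hgG, hgS⟩ := Finset.exists_of_ssubset hSG
    exact nonneg_of_mul_nonneg_left (measureReal_nonneg.trans (hβ g (by simp [hgG, hgS])))
      (hpos g hgG)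
  obtain ⟨g₀, hg₀, hmin⟩ := G.exists_min_image (fun g => (v₀ (.inl g)).real C)
    (hS.mono hSG.subset)
  set μ := (v₀ (.inl g₀)).real C with hμ
  have hμ₀ : 0 < μ := hpos g₀ hg₀
  -- The size of the perturbation: the first two bounds keep the weights below in `[0, 1]`, the last
  -- one keeps `D` near the proportion `r` for everybody.
  set l := min (min r (1 - r)) (ε / 2) with hl
  have hl₀ : 0 < l := lt_min (lt_min hr (by linarith)) (by linarith)
  have hlr : l ≤ r := (min_le_left _ _).trans (min_le_left _ _)
  have hlr' : l ≤ 1 - r := (min_le_left _ _).trans (min_le_right _ _)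
  have hlε : l ≤ ε / 2 := min_le_right _ _
  set mid := (α + β) / 2 with hmid
  have hm₀ : 0 ≤ mid := by linarith
  have hm₁ : mid ≤ 1 := by linarith
  -- A lower bound for the ideal advantage of every member of `G`, where `μ` is the smallest value
  -- of `C` in the group. Half of it may be lost by rounding.
  set γ := l * ((α - β) / 2) * μ with hγ
  have hd : 0 < l * ((α - β) / 2) := mul_pos hl₀ (by linarith)
  have hγ₀ : 0 < γ := mul_pos hd hμ₀
  have hlm : 0 ≤ l * mid := mul_nonneg hl₀.le hm₀
  have hlm' : 0 ≤ l * (1 - mid) := mul_nonneg hl₀.le (by linarith)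
  refine (reach_near_weighted s hg ha hc (η := min (γ / 2) (ε / 2))
    (lt_min (by linarith) (by linarith))).andThen fun s' hs' hext => .done ?_
  obtain ⟨h₁, h₂, h₃, -, h₄⟩ := hs'
  -- With these weights the ideal value of `D` is `r * C + l * (P - mid * C)`, and the threshold
  -- `mid` separates `S` from the rest of `G`.
  obtain ⟨D, hD, hDC, hDv⟩ := h₄ P (C \ P) hP (hC.diff hP) disjoint_sdiff_right
    (r + l * (1 - mid)) (r - l * mid) (by linarith)
    (by linarith) (by linarith) (by linarith)
  refine ⟨h₁, h₂, h₃, D, γ / 2, by linarith, hD, by rwa [union_sdiff_cancel hPC] at hDC,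
    fun v hv => ?_⟩
  have hv' := hext.subset hv
  have key : ∀ q, |(v q).real D - r * (v₀ q).real C -
      l * ((v₀ q).real P - mid * (v₀ q).real C)| ≤ min (γ / 2) (ε / 2) := by
    intro q
    have := hfin v hv' q
    have h := hDv v hv q
    rw [measureReal_sdiff hPC (hP.measurableSet hg.frag),
      hk.real_eq hg hv' hv₀ q hP, hk.real_eq hg hv' hv₀ q hC] at h
    convert h using 2
    ring
  refine ⟨fun g hgS => ?_, fun g hgS => ?_, fun q => ?_⟩
  · have h := (abs_le.1 ((key (.inl g)).trans (min_le_left _ _))).1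
    have h' := mul_le_mul_of_nonneg_left (hmin g (hSG.subset hgS)) hd.le
    rw [hα g hgS] at h
    rw [hk.real_eq hg hv' hv₀ _ hC]
    have e : l * (α * (v₀ (.inl g)).real C - mid * (v₀ (.inl g)).real C) =
      l * ((α - β) / 2) * (v₀ (.inl g)).real C := by rw [hmid]; ring
    rw [e] at h
    linarith
  · have h := (abs_le.1 ((key (.inl g)).trans (min_le_left _ _))).2
    have h' := mul_le_mul_of_nonneg_left (hmin g (Finset.mem_sdiff.1 hgS).1) hd.le
    have h'' := mul_le_mul_of_nonneg_left (hβ g hgS) hl₀.le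
    rw [hk.real_eq hg hv' hv₀ _ hC]
    have e : l * (β * (v₀ (.inl g)).real C) - l * (mid * (v₀ (.inl g)).real C) =
      - (l * ((α - β) / 2) * (v₀ (.inl g)).real C) := by rw [hmid]; ring
    rw [mul_sub] at h
    linarith
  · have := hfin v₀ hv₀ q
    have h := abs_le.1 ((key q).trans (min_le_right _ _))
    rw [hk.real_eq hg hv' hv₀ _ hC]
    have hc₁ : (v₀ q).real C ≤ 1 := measureReal_le_one
    have hp₀ : 0 ≤ (v₀ q).real P := measureReal_nonneg
    have hmc : 0 ≤ mid * (v₀ q).real C := mul_nonneg hm₀ measureReal_nonneg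
    have hmc' : mid * (v₀ q).real C ≤ 1 := mul_le_one₀ hm₁ measureReal_nonneg hc₁
    have hlo := mul_le_mul_of_nonneg_left
      (show -1 ≤ (v₀ q).real P - mid * (v₀ q).real C by linarith) hl₀.le
    have hhi := mul_le_mul_of_nonneg_left
      (show (v₀ q).real P - mid * (v₀ q).real C ≤ 1 by linarith [hle q]) hl₀.le
    rw [abs_le]
    constructor <;> linarith [h.1, h.2]

/-! ### Dividing a piece among a group -/

/-- The pieces `X g` form an envy-free division of `C` among the group `G`, and everybody thinks
that it is nearly exact. -/
structure Stage.IsShare (s : Stage n m) (G : Finset (Fin n)) (C : Set Cake) (ε : ℝ)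
    (X : Fin n → Set Cake) : Prop where
  adapted : ∀ g ∈ G, Adapted s.F (X g)
  disjoint : ∀ g ∈ G, ∀ h ∈ G, g ≠ h → Disjoint (X g) (X h)
  cover : ⋃ g ∈ G, X g = C
  envyFree : ∀ v ∈ s.V, ∀ g ∈ G, ∀ h ∈ G, (v (.inl g)).real (X h) ≤ (v (.inl g)).real (X g)
  near : ∀ v ∈ s.V, ∀ q, ∀ g ∈ G, |(v q).real (X g) - (v q).real C / G.card| ≤ ε

lemma Stage.IsShare.extends {s s' : Stage n m} {G : Finset (Fin n)} {C : Set Cake} {ε : ℝ}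
    {X : Fin n → Set Cake} (h : s.IsShare G C ε X) (hs : s'.Extends s) : s'.IsShare G C ε X :=
  ⟨fun g hg => (h.adapted g hg).refine hs.refines, h.disjoint, h.cover,
    fun v hv => h.envyFree v (hs.subset hv), fun v hv => h.near v (hs.subset hv)⟩

/-- There are as many parts as players, so an injective allocation uses every part. This covers both
ways to stop without a further partition. -/
lemma Stage.isShare_of_parts {s : Stage n m} {G : Finset (Fin n)} {C : Set Cake} {ε : ℝ} {N : ℕ}
    (hN : G.card = N + 1) {X : Fin (N + 1) → Set Cake} (hX : ∀ i, Adapted s.F (X i))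
    (hdis : Pairwise fun i j => Disjoint (X i) (X j)) (hC : ⋃ i, X i = C)
    (hnear : ∀ v ∈ s.V, ∀ i q, |(v q).real (X i) - (v q).real C / (N + 1 : ℕ)| ≤ ε)
    {π : Fin n → Fin (N + 1)} (hπ : InjOn π G)
    (henvy : ∀ v ∈ s.V, ∀ g ∈ G, ∀ i, (v (.inl g)).real (X i) ≤ (v (.inl g)).real (X (π g))) :
    s.IsShare G C ε fun g => X (π g) where
  adapted g _ := hX _
  disjoint g hg h hh hne := hdis fun e => hne (hπ hg hh e)
  cover := by
    have himage : G.image π = Finset.univ :=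
      Finset.eq_univ_of_card _ (by rw [Finset.card_image_of_injOn hπ, hN, Fintype.card_fin])
    rw [← hC]
    ext x
    simp only [mem_iUnion, exists_prop]
    constructor
    · rintro ⟨g, -, hx⟩
      exact ⟨_, hx⟩
    · rintro ⟨i, hx⟩
      obtain ⟨g, hg, rfl⟩ := Finset.mem_image.1 (himage ▸ Finset.mem_univ i)
      exact ⟨g, hg, hx⟩
  envyFree v hv g hg h _ := henvy v hv g hg _
  near v hv q g _ := by
    rw [hN]
    exact hnear v hv _ q

/-- The shares of both parts of a group form shares of the group, if both parts have an
advantage. -/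
lemma Stage.IsShare.combine {s : Stage n m} (hgood : s.Good) {G S : Finset (Fin n)}
    (hS : S.Nonempty) (hSG : S ⊂ G) {C D : Set Cake} (hD : Adapted s.F D)
    (hDC : D ⊆ C) {ε ε' ζ κ : ℝ} {X Y : Fin n → Set Cake} (hX : s.IsShare S D ε' X)
    (hY : s.IsShare (G \ S) (C \ D) ε' Y) (hκ : ε' * G.card ≤ κ) (hε : ε' + ζ ≤ ε)
    (hζ : 0 ≤ ζ) (hε' : 0 ≤ ε')
    (hadv : ∀ v ∈ s.V,
      (∀ g ∈ S, S.card / G.card * (v (.inl g)).real C + κ ≤ (v (.inl g)).real D) ∧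
      (∀ g ∈ G \ S, (v (.inl g)).real D ≤ S.card / G.card * (v (.inl g)).real C - κ) ∧
      ∀ q, |(v q).real D - S.card / G.card * (v q).real C| ≤ ζ) :
    ∃ Z, s.IsShare G C ε Z := by
  classical
  have hTne : (G \ S).Nonempty := Finset.sdiff_nonempty.2 hSG.2
  have hs₁ : (1 : ℝ) ≤ S.card := by exact_mod_cast hS.card_pos
  have ht₁ : (1 : ℝ) ≤ (G \ S).card := by exact_mod_cast hTne.card_pos
  have hst : (S.card : ℝ) + (G \ S).card = G.card := by
    rw [add_comm]
    exact_mod_cast Finset.card_sdiff_add_card_eq_card hSG.subset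
  set σ : ℝ := (S.card : ℝ)
  set τ : ℝ := ((G \ S).card : ℝ)
  set ν : ℝ := (G.card : ℝ)
  have hσ0 : 0 < σ := by linarith
  have hτ0 : 0 < τ := by linarith
  have hν0 : 0 < ν := by linarith
  have hsdiff : ∀ v ∈ s.V, ∀ q, (v q).real (C \ D) = (v q).real C - (v q).real D := by
    intro v hv q
    have := (hgood.valuation v hv q).1
    exact measureReal_sdiff hDC (hD.measurableSet hgood.frag)
  have hXD : ∀ g ∈ S, X g ⊆ D := fun g hg => hX.cover ▸ subset_biUnion_of_mem (u := X) hg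
  have hYD : ∀ g ∈ G \ S, Y g ⊆ C \ D := fun g hg =>
    hY.cover ▸ subset_biUnion_of_mem (u := Y) hg
  have hmem : ∀ g ∈ G, g ∉ S → g ∈ G \ S := fun g hg hgS => Finset.mem_sdiff.2 ⟨hg, hgS⟩
  have hκ' : ε' * σ + ε' * τ ≤ κ := by rwa [← mul_add, hst]
  have hεσ : 0 ≤ ε' * σ := mul_nonneg hε' hσ0.le
  have hετ : 0 ≤ ε' * τ := mul_nonneg hε' hτ0.le
  have hr : ∀ x : ℝ, σ / ν * x = σ * (x / ν) := fun x => by ring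
  have hr' : ∀ x : ℝ, x = σ * (x / ν) + τ * (x / ν) := fun x => by
    rw [← add_mul, hst]; field_simp
  -- The proportional value `C / ν` separates the two groups: each player finds all shares of the
  -- own group at least this good and all shares of the other group at most this good. The margin
  -- `κ` absorbs the error `ε'` of every single share.
  have hlow : ∀ v ∈ s.V, ∀ g ∈ S, ∀ h ∈ S, (v (.inl g)).real C / ν ≤ (v (.inl g)).real (X h) := by
    intro v hv g hg h hh
    have h₁ := (abs_le.1 (hX.near v hv (.inl g) h hh)).1
    have h₂ := (hadv v hv).1 g hg
    rw [hr] at h₂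
    have h₃ : (v (.inl g)).real C / ν + ε' ≤ (v (.inl g)).real D / σ := by
      rw [le_div_iff₀ hσ0]
      linarith
    linarith
  have hhigh : ∀ v ∈ s.V, ∀ g ∈ S, ∀ h ∈ G \ S,
      (v (.inl g)).real (Y h) ≤ (v (.inl g)).real C / ν := by
    intro v hv g hg h hh
    have h₁ := (abs_le.1 (hY.near v hv (.inl g) h hh)).2
    have h₂ := (hadv v hv).1 g hg
    rw [hr] at h₂
    have h₃ : (v (.inl g)).real (C \ D) / τ ≤ (v (.inl g)).real C / ν - ε' := by
      rw [div_le_iff₀ hτ0, hsdiff v hv]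
      linarith [hr' ((v (.inl g)).real C)]
    linarith
  have hlow' : ∀ v ∈ s.V, ∀ g ∈ G \ S, ∀ h ∈ G \ S,
      (v (.inl g)).real C / ν ≤ (v (.inl g)).real (Y h) := by
    intro v hv g hg h hh
    have h₁ := (abs_le.1 (hY.near v hv (.inl g) h hh)).1
    have h₂ := (hadv v hv).2.1 g hg
    rw [hr] at h₂
    have h₃ : (v (.inl g)).real C / ν + ε' ≤ (v (.inl g)).real (C \ D) / τ := by
      rw [le_div_iff₀ hτ0, hsdiff v hv]
      linarith [hr' ((v (.inl g)).real C)]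
    linarith
  have hhigh' : ∀ v ∈ s.V, ∀ g ∈ G \ S, ∀ h ∈ S,
      (v (.inl g)).real (X h) ≤ (v (.inl g)).real C / ν := by
    intro v hv g hg h hh
    have h₁ := (abs_le.1 (hX.near v hv (.inl g) h hh)).2
    have h₂ := (hadv v hv).2.1 g hg
    rw [hr] at h₂
    have h₃ : (v (.inl g)).real D / σ ≤ (v (.inl g)).real C / ν - ε' := by
      rw [div_le_iff₀ hσ0]
      linarith
    linarith
  refine ⟨fun g => if g ∈ S then X g else Y g, ?_, ?_, ?_, ?_, ?_⟩
  · intro g hg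
    by_cases hgS : g ∈ S
    · simpa only [hgS, if_true] using hX.adapted g hgS
    · simpa only [hgS, if_false] using hY.adapted g (hmem g hg hgS)
  · intro g hg h hh hne
    by_cases hgS : g ∈ S <;> by_cases hhS : h ∈ S <;> simp only [hgS, hhS, if_true, if_false]
    · exact hX.disjoint g hgS h hhS hne
    · exact disjoint_sdiff_right.mono (hXD g hgS) (hYD h (hmem h hh hhS))
    · exact disjoint_sdiff_left.mono (hYD g (hmem g hg hgS)) (hXD h hhS)
    · exact hY.disjoint g (hmem g hg hgS) h (hmem h hh hhS) hne
  · rw [← union_sdiff_cancel hDC, ← hY.cover]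
    nth_rw 1 [← hX.cover]
    ext x
    simp only [mem_iUnion, exists_prop, mem_union]
    constructor
    · rintro ⟨g, hg, hx⟩
      by_cases hgS : g ∈ S
      · exact Or.inl ⟨g, hgS, by simpa only [hgS, if_true] using hx⟩
      · exact Or.inr ⟨g, hmem g hg hgS, by simpa only [hgS, if_false] using hx⟩
    · rintro (⟨g, hg, hx⟩ | ⟨g, hg, hx⟩)
      · exact ⟨g, hSG.subset hg, by simpa only [hg, if_true] using hx⟩
      · exact ⟨g, (Finset.mem_sdiff.1 hg).1,
          by simpa only [(Finset.mem_sdiff.1 hg).2, if_false] using hx⟩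
  · intro v hv g hg h hh
    by_cases hgS : g ∈ S <;> by_cases hhS : h ∈ S <;> simp only [hgS, hhS, if_true, if_false]
    · exact hX.envyFree v hv g hgS h hhS
    · exact (hhigh v hv g hgS h (hmem h hh hhS)).trans (hlow v hv g hgS g hgS)
    · exact (hhigh' v hv g (hmem g hg hgS) h hhS).trans
        (hlow' v hv g (hmem g hg hgS) g (hmem g hg hgS))
    · exact hY.envyFree v hv g (hmem g hg hgS) h (hmem h hh hhS)
  · intro v hv q g hg
    have hq := abs_le.1 ((hadv v hv).2.2 q)
    rw [hr] at hq
    -- Dividing by a group size, which is at least one, does not enlarge the error `ζ`.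
    have hζσ : ζ ≤ ζ * σ := le_mul_of_one_le_right hζ hs₁
    have hζτ : ζ ≤ ζ * τ := le_mul_of_one_le_right hζ ht₁
    by_cases hgS : g ∈ S <;> simp only [hgS, if_true, if_false]
    · have h₁ := abs_le.1 (hX.near v hv q g hgS)
      have h₂ : (v q).real D / σ ≤ (v q).real C / ν + ζ := by
        rw [div_le_iff₀ hσ0]
        linarith
      have h₃ : (v q).real C / ν - ζ ≤ (v q).real D / σ := by
        rw [le_div_iff₀ hσ0]
        linarith
      rw [abs_le]
      constructor <;> linarith [h₁.1, h₁.2]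
    · have h₁ := abs_le.1 (hY.near v hv q g (hmem g hg hgS))
      rw [hsdiff v hv] at h₁
      have h₂ : ((v q).real C - (v q).real D) / τ ≤ (v q).real C / ν + ζ := by
        rw [div_le_iff₀ hτ0]
        linarith [hr' ((v q).real C)]
      have h₃ : (v q).real C / ν - ζ ≤ ((v q).real C - (v q).real D) / τ := by
        rw [le_div_iff₀ hτ0]
        linarith [hr' ((v q).real C)]
      rw [abs_le]
      constructor <;> linarith [h₁.1, h₁.2]

/-! ### The recursive protocol -/

lemma omegaCost_of_three_le (σ : PartitionRule n) {G : Finset (Fin n)} (h : 3 ≤ G.card) :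
    omegaCost σ G = 2 + omegaCost σ (σ ⟨G, h⟩).1 + omegaCost σ (G \ (σ ⟨G, h⟩).1) := by
  rw [omegaCost, dif_pos h]

lemma omegaCost_of_card_lt_three (σ : PartitionRule n) {G : Finset (Fin n)} (h : ¬ 3 ≤ G.card) :
    omegaCost σ G = G.card - 1 := by
  rw [omegaCost, dif_neg h]

lemma one_le_omegaCost (σ : PartitionRule n) {G : Finset (Fin n)} (h : 2 ≤ G.card) :
    1 ≤ omegaCost σ G := by
  by_cases h₃ : 3 ≤ G.card
  · rw [omegaCost_of_three_le σ h₃]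
    omega
  · rw [omegaCost_of_card_lt_three σ h₃]
    omega

/-- If both parts have at least two players, the recursion even gives `2 * |G| - 4`. The extremal
case is a singleton part, where `2 * 1 - 3` truncates to `0`. -/
lemma omegaCost_le (σ : PartitionRule n) (G : Finset (Fin n)) (hG : G.Nonempty) :
    omegaCost σ G ≤ 2 * G.card - 3 := by
  induction G using Finset.strongInduction with
  | H G ih =>
    by_cases h : 3 ≤ G.card
    · rw [omegaCost_of_three_le σ h]
      obtain ⟨S, hS, hSG⟩ := σ ⟨G, h⟩
      dsimp only at hSG ⊢
      have hT : (G \ S).Nonempty := Finset.sdiff_nonempty.2 hSG.2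
      have h₁ := ih S hSG hS
      have h₂ := ih (G \ S) (Finset.sdiff_ssubset hSG.subset hS) hT
      have h₃ := hS.card_pos
      have h₄ := hT.card_pos
      have h₅ := Finset.card_sdiff_add_card_eq_card hSG.subset
      omega
    · rw [omegaCost_of_card_lt_three σ h]
      have := hG.card_pos
      omega

/-- The bound already holds for each partition rule separately. -/
lemma averageOmegaCost_le (hn : 1 ≤ n) : averageOmegaCost n ≤ ((2 * n - 3 : ℕ) : ℝ) := by
  have : NeZero n := ⟨by omega⟩
  refine div_le_of_le_mul₀ (Nat.cast_nonneg _) (Nat.cast_nonneg _) ?_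
  calc (∑ σ : PartitionRule n, (omegaCost σ Finset.univ : ℝ))
      ≤ ∑ _σ : PartitionRule n, ((2 * n - 3 : ℕ) : ℝ) := by
        refine Finset.sum_le_sum fun σ _ => Nat.cast_le.2 ?_
        simpa using omegaCost_le σ Finset.univ Finset.univ_nonempty
    _ = _ := by
        rw [Finset.sum_const, Finset.card_univ, nsmul_eq_mul, mul_comm]

/-- The group `G` has divided the piece `C`, with the budget `a₀`, `c₀` left, and the groups of
the stage `s` that are not part of `G` are still present. -/
def Stage.HasDivided (s : Stage n m) (G : Finset (Fin n)) (C : Set Cake) (ε : ℝ) (a₀ : ℕ)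
    (c₀ : PartitionRule n → ℕ) (s' : Stage n m) : Prop :=
  a₀ ≤ s'.a ∧ (∀ σ, c₀ σ ≤ s'.c σ) ∧ (∀ H ∈ s.L, ¬ H ⊆ G → H ∈ s'.L) ∧ ∃ X, s'.IsShare G C ε X

lemma Stage.isShare_singleton (s : Stage n m) (g : Fin n) {C : Set Cake} (hC : Adapted s.F C)
    {ε : ℝ} (hε : 0 ≤ ε) : s.IsShare {g} C ε fun _ => C where
  adapted _ _ := hC
  disjoint h hh h' hh' hne := by
    rw [Finset.mem_singleton.1 hh, Finset.mem_singleton.1 hh'] at hne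
    exact absurd rfl hne
  cover := by simp
  envyFree _ _ _ _ _ _ := le_rfl
  near _ _ _ _ _ := by simpa using hε

/-- If the players in a group disagree on the relative value of a piece, then the piece is
controversial. -/
lemma exists_isControversial {v : Player n m → Measure Cake} {G : Finset (Fin n)} {C P : Set Cake}
    (hPC : P ⊆ C) (hpos : ∀ g ∈ G, 0 < (v (.inl g)).real C) {p g : Fin n} (hp : p ∈ G) (hg : g ∈ G)
    (hne : (v (.inl p)).real P / (v (.inl p)).real C ≠ (v (.inl g)).real P / (v (.inl g)).real C) :
    ∃ S, IsControversial v G S C P := by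
  classical
  set ρ : Fin n → ℝ := fun h => (v (.inl h)).real P / (v (.inl h)).real C with hρ
  obtain ⟨x, hx, hmax⟩ := G.exists_max_image ρ ⟨p, hp⟩
  -- The members of `S` attain the largest ratio, so they agree exactly on `α`; the largest ratio
  -- outside `S` serves as `β`.
  set S := G.filter fun h => ρ h = ρ x with hS
  have hSG : S ⊂ G := by
    refine (Finset.filter_subset _ _).ssubset_of_ne fun e => hne ?_
    have h : ∀ y ∈ G, ρ y = ρ x := Finset.filter_eq_self.1 e
    exact (h p hp).trans (h g hg).symm
  have hT : (G \ S).Nonempty := Finset.sdiff_nonempty.2 hSG.2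
  obtain ⟨y, hy, hmax'⟩ := (G \ S).exists_max_image ρ hT
  have hval : ∀ h ∈ G, (v (.inl h)).real P = ρ h * (v (.inl h)).real C := fun h hh =>
    (div_mul_cancel₀ _ (hpos h hh).ne').symm
  obtain ⟨hyG, hyS⟩ := Finset.mem_sdiff.1 hy
  refine ⟨S, ⟨x, Finset.mem_filter.2 ⟨hx, rfl⟩⟩, hSG, hPC, hpos, ρ x, ρ y, ?_, ?_, ?_⟩
  · exact lt_of_le_of_ne (hmax y hyG) fun e => hyS (Finset.mem_filter.2 ⟨hyG, e⟩)
  · intro a ha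
    obtain ⟨haG, ha⟩ := Finset.mem_filter.1 ha
    rw [hval a haG, ha]
  · intro a ha
    rw [hval a (Finset.mem_sdiff.1 ha).1]
    exact mul_le_mul_of_nonneg_right (hmax' a ha) (hpos a (Finset.mem_sdiff.1 ha).1).le

/-- An announcement must be justified for every compatible valuation; the same `α` and `β` work
because only known values are involved. -/
lemma Stage.ValuesKnown.isControversial {s : Stage n m} (hk : s.ValuesKnown) (hg : s.Good)
    {v v' : Player n m → Measure Cake} (hv : v ∈ s.V) (hv' : v' ∈ s.V) {G S : Finset (Fin n)}
    {C P : Set Cake} (hC : Adapted s.F C) (hP : Adapted s.F P) (h : IsControversial v G S C P) :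
    IsControversial v' G S C P := by
  obtain ⟨h₁, h₂, h₃, h₄, α, β, h₅, h₆, h₇⟩ := h
  refine ⟨h₁, h₂, h₃, fun a ha => ?_, α, β, h₅, fun a ha => ?_, fun a ha => ?_⟩
  · rw [hk.real_eq hg hv' hv _ hC]
    exact h₄ a ha
  · rw [hk.real_eq hg hv' hv _ hC, hk.real_eq hg hv' hv _ hP]
    exact h₆ a ha
  · rw [hk.real_eq hg hv' hv _ hC, hk.real_eq hg hv' hv _ hP]
    exact h₇ a ha

/-- The two parts of a group are served one after the other. For the induction, a budget `a₀`, `c₀`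
is therefore set aside for what comes later, and groups not contained in `G` must survive. -/
theorem reach_hasDivided (G : Finset (Fin n)) : ∀ (s : Stage n m) (C : Set Cake) (ε : ℝ) (a₀ : ℕ)
    (c₀ : PartitionRule n → ℕ), G.Nonempty → s.Good → Adapted s.F C → G ∈ s.L →
      (∀ v ∈ s.V, ∀ g ∈ G, 0 < (v (.inl g)).real C) → 0 < ε → a₀ + (2 * G.card - 3) ≤ s.a →
      (∀ σ, c₀ σ + omegaCost σ G ≤ s.c σ) → Reach (s.HasDivided G C ε a₀ c₀) s := by
  induction G using Finset.strongInduction with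
  | H G ih =>
    intro s C ε a₀ c₀ hGne hg hC hGL hpos hε ha hc
    rcases Nat.eq_or_lt_of_le hGne.card_pos with h₁ | h₂
    · obtain ⟨g, rfl⟩ := Finset.card_eq_one.1 h₁.symm
      exact .done ⟨by omega, fun σ => (Nat.le_add_right _ _).trans (hc σ), fun H hH _ => hH,
        _, s.isShare_singleton g hC hε.le⟩
    replace h₂ : 2 ≤ G.card := h₂
    obtain ⟨p, hp⟩ := hGne
    obtain ⟨N, hN⟩ : ∃ N, G.card = N + 1 := ⟨G.card - 1, by omega⟩
    have hcost : ∀ σ, 1 ≤ omegaCost σ G := fun σ => one_le_omegaCost σ h₂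
    refine (reach_near_equal s hg (.inl p) N (a := s.a - 1) (c := fun σ => s.c σ - 1) (by omega)
      (fun σ => by have := hc σ; have := hcost σ; omega) hε).andThen fun s₁ hs₁ hext₁ => ?_
    obtain ⟨ha₁, hc₁, hL₁, hk₁, hX⟩ := hs₁
    obtain ⟨X, hXa, hXd, hXC, hXv⟩ := hX C hC
    have hg₁ := hext₁.good hg
    have hC₁ : Adapted s₁.F C := hC.refine hext₁.refines
    obtain ⟨v₀, hv₀⟩ := hg₁.nonempty
    have hv₀s := hext₁.subset hv₀
    have finish : ∀ π : Fin n → Fin (N + 1), InjOn π G →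
        (∀ g ∈ G, ∀ i, (v₀ (.inl g)).real (X i) ≤ (v₀ (.inl g)).real (X (π g))) →
        Reach (s.HasDivided G C ε a₀ c₀) s₁ := fun π hπ henvy =>
      .done ⟨by omega, fun σ => by have := hc σ; have := hcost σ; rw [hc₁]; dsimp only; omega,
        fun H hH _ => hL₁ ▸ hH, _, s₁.isShare_of_parts hN hXa hXd hXC
          (fun v hv i q => (hXv v hv i).2 q) hπ fun v hv g hgG i => by
            rw [hk₁.real_eq hg₁ hv hv₀ _ (hXa _), hk₁.real_eq hg₁ hv hv₀ _ (hXa _)]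
            exact henvy g hgG i⟩
    rcases Nat.eq_or_lt_of_le h₂ with h₂ | h₃
    · obtain ⟨q, hq, hqp⟩ : ∃ q ∈ G, q ≠ p := G.exists_mem_ne (by omega) p
      obtain rfl : N = 1 := by omega
      obtain ⟨i₀, -, hi₀⟩ := (Finset.univ : Finset (Fin 2)).exists_max_image
        (fun i => (v₀ (.inl q)).real (X i)) Finset.univ_nonempty
      have hG : G = {p, q} := (Finset.eq_of_subset_of_card_le
        (by intro x hx; rcases Finset.mem_insert.1 hx with rfl | hx
            · exact hp
            · rwa [Finset.mem_singleton.1 hx]) (by rw [Finset.card_pair hqp.symm, ← h₂])).symm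
      -- Cut and choose: `q` takes a favourite part, and `p`, for whom both are equal, gets the
      -- other one, which in `Fin 2` is `i₀ + 1`.
      refine finish (fun g => if g = q then i₀ else i₀ + 1) ?_ ?_
      · intro x hx y hy
        simp only [hG, Finset.coe_insert, Finset.coe_singleton, mem_insert_iff,
          mem_singleton_iff] at hx hy
        have hi : ∀ i : Fin 2, i ≠ i + 1 := by decide
        replace hi := hi i₀
        rcases hx with rfl | rfl <;> rcases hy with rfl | rfl <;>
          simp [hqp, hqp.symm, hi, hi.symm]
      · intro g hgG i
        rw [hG] at hgG
        rcases Finset.mem_insert.1 hgG with rfl | hgG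
        · rw [(hXv v₀ hv₀ _).1, (hXv v₀ hv₀ _).1]
        · rw [Finset.mem_singleton.1 hgG, if_pos rfl]
          exact hi₀ i (Finset.mem_univ _)
    replace h₃ : 3 ≤ G.card := h₃
    by_cases hagree : ∀ g ∈ G, ∀ i,
        (v₀ (.inl g)).real (X i) = (v₀ (.inl g)).real C / (N + 1 : ℕ)
    · obtain ⟨π, hπ⟩ : ∃ π : Fin n → Fin (N + 1), InjOn π G := by
        classical
        let e := G.equivFinOfCardEq hN
        refine ⟨fun g => if h : g ∈ G then e ⟨g, h⟩ else 0, fun x hx y hy hxy => ?_⟩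
        simp only [Finset.mem_coe.1 hx, Finset.mem_coe.1 hy, dif_pos] at hxy
        exact congrArg Subtype.val (e.injective hxy)
      exact finish π hπ fun g hgG i => by rw [hagree g hgG, hagree g hgG]
    push Not at hagree
    obtain ⟨g, hgG, i, hgi⟩ := hagree
    have hpos₀ := hpos v₀ hv₀s
    obtain ⟨S, hcon⟩ : ∃ S, IsControversial v₀ G S C (X i) := by
      -- For `p` the relative value of `X i` is exactly `1 / (N + 1)`, and for `g` it is not.
      refine exists_isControversial (hXC ▸ subset_iUnion X i) hpos₀ hp hgG fun e => hgi ?_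
      rw [(hXv v₀ hv₀ i).1, div_div_cancel_left' (hpos₀ p hp).ne',
        eq_div_iff (hpos₀ g hgG).ne'] at e
      rw [← e]
      ring
    have hcon' : ∀ v ∈ s₁.V, IsControversial v G S C (X i) := fun v hv =>
      hk₁.isControversial hg₁ hv₀ hv hC₁ (hXa i) hcon
    obtain ⟨hS, hSG, -⟩ := hcon
    set T := G \ S with hT
    have hTne : T.Nonempty := Finset.sdiff_nonempty.2 hSG.2
    have hTG : T ⊂ G := Finset.sdiff_ssubset hSG.subset hS
    have hcard : T.card + S.card = G.card := Finset.card_sdiff_add_card_eq_card hSG.subset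
    have hSpos := hS.card_pos
    have hTpos := hTne.card_pos
    set c₂ : PartitionRule n → ℕ := fun σ => c₀ σ + omegaCost σ T + omegaCost σ S with hc₂
    -- Of the two `ω`s for this group one is already spent; the summand `1` pays for exploiting the
    -- controversial piece.
    refine .regroup G S (fragmentsIn s₁.F C) (fragmentsIn s₁.F (X i)) (fun σ => c₂ σ + 1) h₃
      (hL₁ ▸ hGL) (fun v hv => ?_) (fun σ hσ => ?_) ?_
    · rw [hC₁.unionOf_fragmentsIn hg₁.frag, (hXa i).unionOf_fragmentsIn hg₁.frag]
      exact hcon' v hv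
    · have := hc σ
      rw [omegaCost_of_three_le σ h₃, ← hσ] at this
      rw [hc₁]
      change c₀ σ + omegaCost σ (G \ S) + omegaCost σ S + 1 ≤ s.c σ - 1
      omega
    set s₂ : Stage n m := { s₁ with
      L := insert S (insert (G \ S) (s₁.L.erase G)), c := fun σ => c₂ σ + 1 } with hs₂
    have hg₂ : s₂.Good := ⟨hg₁.frag, hg₁.nonempty, hg₁.valuation⟩
    have hGpos : (0 : ℝ) < G.card := by exact_mod_cast (by omega : 0 < G.card)
    have hrpos : (0 : ℝ) < S.card / G.card := div_pos (by exact_mod_cast hSpos) hGpos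
    have hrlt : (S.card : ℝ) / G.card < 1 := by
      rw [div_lt_one hGpos]
      exact_mod_cast (by omega : S.card < G.card)
    refine (reach_advantage s₂ hg₂ hk₁ hC₁ (hXa i) hcon' hrpos hrlt (a := s.a - 2) (c := c₂)
      (by change s.a - 2 < s₁.a; omega) (fun σ => le_rfl) (half_pos hε)).andThen
        fun s₃ hs₃ hext₃ => ?_
    obtain ⟨ha₃, hc₃, hL₃, D, κ, hκ, hD, hDC, hadv⟩ := hs₃
    have hg₃ := hext₃.good hg₂
    have hC₃ : Adapted s₃.F C := hC₁.refine hext₃.refines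
    have hpos₃ : ∀ v ∈ s₃.V, ∀ g ∈ G, 0 < (v (.inl g)).real C := fun v hv =>
      hpos v (hext₁.subset (hext₃.subset hv))
    -- The first bound lets the margin absorb the errors of all shares; the second leaves `ε / 2`
    -- for the deviation of `D` from its proportion.
    set ε' := min (κ / G.card) (ε / 2) with hε'
    have hε'₀ : 0 < ε' := lt_min (div_pos hκ hGpos) (half_pos hε)
    refine (ih S hSG s₃ D ε' (a₀ + (2 * T.card - 3)) (fun σ => c₀ σ + omegaCost σ T) hS hg₃ hD
      (by rw [hL₃]; exact Finset.mem_insert_self _ _) ?_ hε'₀ (by rw [ha₃]; omega)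
      (fun σ => by rw [hc₃])).andThen fun s₄ hs₄ hext₄ => ?_
    · intro v hv g hgS
      have h := (hadv v hv).1 g hgS
      have h' := mul_pos hrpos (hpos₃ v hv g (hSG.subset hgS))
      linarith
    obtain ⟨ha₄, hc₄, hL₄, Y, hY⟩ := hs₄
    have hg₄ := hext₄.good hg₃
    refine (ih T hTG s₄ (C \ D) ε' a₀ c₀ hTne hg₄ ((hC₃.diff hD).refine hext₄.refines) ?_ ?_
      hε'₀ ha₄ hc₄).andThen fun s₅ hs₅ hext₅ => .done ?_
    -- The division among `S` has not affected the group `T`, which is not contained in `S`.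
    · refine hL₄ T ?_ fun h => ?_
      · rw [hL₃]
        exact Finset.mem_insert_of_mem (Finset.mem_insert_self _ _)
      · obtain ⟨x, hx⟩ := hTne
        exact (Finset.mem_sdiff.1 hx).2 (h hx)
    · intro v hv g hgT
      have hv₃ := hext₄.subset hv
      have := (hg₄.valuation v hv (.inl g)).1
      rw [measureReal_sdiff hDC (hD.measurableSet hg₃.frag)]
      have h := (hadv v hv₃).2.1 g hgT
      have h' := mul_pos (sub_pos.2 hrlt) (hpos₃ v hv₃ g (hTG.subset hgT))
      linarith
    obtain ⟨ha₅, hc₅, hL₅, Z, hZ⟩ := hs₅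
    refine ⟨ha₅, hc₅, fun H hH hHG => ?_, ?_⟩
    · refine hL₅ H (hL₄ H ?_ fun h => hHG (h.trans hSG.subset)) fun h => hHG (h.trans hTG.subset)
      rw [hL₃]
      refine Finset.mem_insert_of_mem (Finset.mem_insert_of_mem (Finset.mem_erase.2 ⟨?_, hL₁ ▸ hH⟩))
      rintro rfl
      exact hHG subset_rfl
    · have hext := hext₅.trans hext₄
      exact (hY.extends hext₅).combine (hext₅.good hg₄) hS hSG (hD.refine hext.refines) hDC hZ
        (by rw [← le_div_iff₀ hGpos]; exact min_le_left _ _)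
        (by linarith [min_le_right (κ / G.card) (ε / 2)] : ε' + ε / 2 ≤ ε) (half_pos hε).le
        hε'₀.le fun v hv => hadv v (hext.subset hv)

/-! ### The end and the beginning of an execution -/

lemma Stage.IsShare.canFinish {s : Stage n m} (hg : s.Good) (hn : 1 ≤ n) {ε : ℝ}
    {X : Fin n → Set Cake} (hX : s.IsShare Finset.univ univ ε X) :
    CanFinish (fun v X => IsDivision X ∧ IsEnvyFree v X ∧ IsNearExact v ε X) s := by
  have : ∀ j, ∃ g, s.F j ⊆ X g := by
    intro j
    rcases (s.F j).eq_empty_or_nonempty with he | ⟨x, hx⟩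
    -- Empty fragments may go to anybody.
    · exact ⟨⟨0, hn⟩, he ▸ empty_subset _⟩
    · have hx' : x ∈ ⋃ g ∈ (Finset.univ : Finset (Fin n)), X g := hX.cover ▸ mem_univ x
      simp only [mem_iUnion] at hx'
      obtain ⟨g, hgu, hxg⟩ := hx'
      exact ⟨g, (hX.adapted g hgu j).resolve_right fun h => disjoint_left.1 h hx hxg⟩
  choose owner howner using this
  have hdis : ∀ g h, g ≠ h → Disjoint (X g) (X h) := fun g h =>
    hX.disjoint g (Finset.mem_univ _) h (Finset.mem_univ _)
  have hXeq : (fun a => unionOf s.F (Finset.univ.filter fun j => owner j = a)) = X := by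
    funext a
    ext x
    rw [mem_unionOf]
    constructor
    · rintro ⟨j, hj, hx⟩
      rw [← (Finset.mem_filter.1 hj).2]
      exact howner j hx
    · intro hx
      obtain ⟨j, hj⟩ := hg.frag.cover x
      refine ⟨j, Finset.mem_filter.2 ⟨Finset.mem_univ _, ?_⟩, hj⟩
      by_contra hne
      exact disjoint_left.1 (hdis _ _ hne) (howner j hj) hx
  refine ⟨owner, fun v hv => ?_⟩
  rw [hXeq]
  refine ⟨⟨by simpa using hX.cover, hdis⟩, fun a b => hX.envyFree v hv a (Finset.mem_univ _) b
    (Finset.mem_univ _), fun q a => ?_⟩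
  have := (hg.valuation v hv q).1
  simpa using hX.near v hv q a (Finset.mem_univ _)

/-- The stage at the beginning. -/
def Stage.initial (n m : ℕ) : Stage n m where
  k := 1
  F := fun _ => univ
  V := {v | ∀ q, IsValuation (v q)}
  L := {Finset.univ}
  a := 2 * n - 3
  b := 0
  c := fun σ => omegaCost σ Finset.univ

/-- Some valuation must exist, so that the initial knowledge is consistent. -/
lemma isValuation_volume : IsValuation (volume : Measure Cake) :=
  ⟨inferInstance, inferInstance⟩

lemma Stage.good_initial (n m : ℕ) : (Stage.initial n m).Good where
  frag :=
    { measurable := fun _ => MeasurableSet.univ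
      disjoint := fun i j h => absurd (Subsingleton.elim (α := Fin 1) i j) h
      cover := fun x => ⟨(0 : Fin 1), mem_univ x⟩ }
  nonempty := ⟨fun _ => volume, fun _ => isValuation_volume⟩
  valuation := fun _ hv => hv

end CakeCutting

end

theorem theorem3p5 (n m : ℕ) (hn : 1 ≤ n) (ε : ℝ) (hε : 0 < ε) :
    ∃ (p : CakeCutting.Protocol n m 1) (obs : CakeCutting.Observer n),
      -- every execution, whatever the valuations are
      (∀ v : CakeCutting.Player n m → MeasureTheory.Measure CakeCutting.Cake,
        (∀ q, CakeCutting.IsValuation (v q)) →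
          (∃ h X, CakeCutting.IsFullRun v p h X) ∧
          ∀ h X, CakeCutting.IsFullRun v p h X →
            CakeCutting.IsDivision X ∧
            CakeCutting.IsEnvyFree v X ∧
            CakeCutting.IsNearExact v ε X ∧
            CakeCutting.CounterWorks obs h ∧
            CakeCutting.PartitionsGenuine v h ∧
            ∀ σ : CakeCutting.PartitionRule n, CakeCutting.FollowsRule σ h →
              CakeCutting.omegaCount obs h ≤ CakeCutting.omegaCost σ Finset.univ) ∧
      -- the worst case; for `n = 1` the subtraction gives `0`, that is, no cuts
      obs [] = Ordinal.omega0 * ((2 * n - 3 : ℕ) : Ordinal.{0}) ∧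
      -- the average over random partitions
      CakeCutting.averageOmegaCost n ≤ ((2 * n - 3 : ℕ) : ℝ) := by
  have : NeZero n := ⟨by omega⟩
  have hg := CakeCutting.Stage.good_initial n m
  have hreach := (CakeCutting.reach_hasDivided Finset.univ (CakeCutting.Stage.initial n m) univ ε 0
    (fun _ => 0) Finset.univ_nonempty hg .univ (Finset.mem_singleton_self _)
    (fun v hv g _ => by have := (hv (.inl g)).1; simp) hε
    (by simp [CakeCutting.Stage.initial]) (fun σ => by simp [CakeCutting.Stage.initial])).andThen
      fun s' hs' hext => .done (hs'.2.2.2.choose_spec.canFinish (hext.good hg) hn)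
  -- The counter starts exactly at the budget of the initial stage, so no fall is pending and the
  -- extra `1` vanishes.
  obtain ⟨p, obs, hobs, hmeets⟩ := hreach.exists_protocol hg (2 * n - 3) 0 (.inr ⟨rfl, le_rfl⟩)
  refine ⟨p, obs, fun v hv => ?_, by simpa using hobs, CakeCutting.averageOmegaCost_le hn⟩
  obtain ⟨hrun, hall⟩ := hmeets v hv
  refine ⟨hrun, fun h X hX => ?_⟩
  obtain ⟨⟨h₁, h₂, h₃⟩, h₄, h₅, h₆⟩ := hall h X hX
  exact ⟨h₁, h₂, h₃, h₄, CakeCutting.partitionsGenuineFrom_univ h₅,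
    fun σ hσ => by simpa [CakeCutting.Stage.initial] using h₆ σ hσ⟩
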